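/- **Patterns and tile systems.** A pattern of width $w$ and height $h$ is a map $P:\{0,\dots,w-1\}\times\{0,\dots,h-1\}\to\mathbb N$ (color codes). $P$ *includes* a pattern $Q$ if some translate of $Q$ is a subpattern of $P$. A tile type $t$ is a (non-rotatable) square with a color and four labels $t(\mathtt N),t(\mathtt W),t(\mathtt S),t(\mathtt E)$. A rectilinear tile assembly system (RTAS) is a pair $(T,\sigma_L)$ of a finite set $T$ of tile types and an L-shape seed $\sigma_L$ of width $w\ge1$ and height $h\ge1$, which exposes a north label at each $(x,0)$, $1\le x\le w$, and an east label at each $(0,y)$, $1\le y\le h$. Starting from the seed, tiles (copies of types in $T$) attach one at a time: a tile can attach at a vacant position $(x,y)$, $1\le x\le w$, $1\le y\le h$, iff its west label equals the east label at $(x-1,y)$ and its south label equals the north label at $(x,y-1)$ (both neighbors being present). If all of $\{1,\dots,w\}\times\{1,\dots,h\}$ gets tiled, the resulting $w\times h$ color pattern is a *terminal pattern*; the RTAS *uniquely self-assembles* $P$ if $P$ is its one and only terminal pattern. The RTAS is *directed* if any two distinct $t_1,t_2\in T$ satisfy $t_1(\mathtt W)\ne t_2(\mathtt W)$ or $t_1(\mathtt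 S)\neq t_2(\mathtt S)$. Two tile sets are *isomorphic (modulo glue renaming)* if one arises from the other, colors being kept, by an injective renaming of the labels on west/east sides and an injective renaming of the labels on north/south sides (the two renamings are independent, as west/east labels are never compared with north/south labels). **The tile set $T_{\rm eval}$** has the following 21 tile types, written $(\mathtt N,\mathtt W,\mathtt S,\mathtt E)$, over the glues $\mathtt{F,T,f,t,s,c,n,v}$ and 11 colors: cyan: $(F,F,F,F),(T,F,T,F),(F,T,F,T),(T,T,T,T)$; CE: $(F,f,F,f),(F,f,T,s),(F,s,F,s)$; white: $(n,f,n,f),(n,t,n,t)$; black: $(v,f,v,f),(v,t,v,t)$; DGNL-white: $(F,F,n,f),(F,T,n,t)$; DGNL-black: $(F,F,v,f),(T,T,v,t)$; Init: $(c,f,c,F),(c,t,c,T)$; Sat: $(F,s,c,F)$; yellow: $(T,s,T,s)$; red: $(c,F,c,f)$; blue: $(c,T,c,t)$. **The pattern GADGET** (width 265, height 240) is the pattern that $T_{\rm eval}$ assembles from the following seed. List 32 words $b=b_1b_2b_3b_4\in\{F,T\}^4$ with a type: first the white ones, with $b_1b_2=FF,FT,TF,TT$ in this order, then the black ones, with $b_1b_2=TT,TF,FT,FF$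 in this order; for each $b_1b_2$, let $b_3b_4=TT,TF,FT,FF$ in this order. Put $z=n$ for white words and $z=v$ for black ones. The $x$-axis glues are, from west to east, $$cTcn\;\cdot\;cc\,TT\,TTT\,F\,TT\,F^{25}\,T\,cF\,c\;\cdot\;nvccncTcccnccn\;\cdot\;X_1X_2\cdots X_{32},$$ where the word number $i$ contributes $X_i=z^4cc$ if $b_1=F$ and $X_i=z^5cc$ if $b_1=T$. The $y$-axis glues are, from bottom to top, $$F\,s\,T^{25}F^{25}\,TT\,s\;\cdot\;s\,s\,f^{7}\;\cdot\;Y_1Y_2\cdots Y_{32},$$ where $Y_i=b_2b_3b_4e\,e$ if $b_1=F$ and $Y_i=b_1b_2b_3b_4e\,e$ if $b_1=T$, with $e=s$ for white words and $e=f$ for black ones. **Property (isomorphism).** Let $(T,\sigma_L)$ be a directed RTAS that uniquely self-assembles a pattern including GADGET. If $|T|\le 21$, then $T$ is isomorphic to $T_{\rm eval}$ (modulo glue renaming). Consequently, no directed RTAS with strictly fewer than 21 tile types uniquely self-assembles a pattern including GADGET. -/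

import Mathlib

/-!
Rectilinear tile assembly systems (RTAS), the tile set `Teval` of 21 tile types, and the
pattern `gadget`.
-/

namespace RTAS

/-! ### Patterns -/

/-- A rectangular (color) pattern of width `w` and height `h`; colors are natural numbers. -/
abbrev Pattern (w h : ℕ) : Type := Fin w → Fin h → ℕ

/-- The pattern `P` includes the pattern `Q`: some translate of `Q` is a subpattern of `P`. -/
def Pattern.Includes {w h w' h' : ℕ} (P : Pattern w h) (Q : Pattern w' h') : Prop :=
  ∃ a b : ℕ, a + w' ≤ w ∧ b + h' ≤ h ∧
    ∀ (x : Fin w) (y : Fin h) (x' : Fin w') (y' : Fin h'),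
      (x : ℕ) = a + x' → (y : ℕ) = b + y' → P x y = Q x' y'

/-! ### Tile types, seeds, and rectilinear tile assembly systems -/

/-- A (non-rotatable) tile type: labels of the four sides, read counter-clockwise starting at
north, and a color. -/
@[ext]
structure TileType (L : Type*) where
  north : L
  west : L
  south : L
  east : L
  color : ℕ
deriving DecidableEq

/-- An L-shape seed of width `width` and height `height`.  The assembly process sees only the
labels that the seed exposes: `xAxis x` is the north label of the seed tile at `(x, 0)`, for
`1 ≤ x ≤ width`, and `yAxis y` is the east label of the seed tile at `(0, y)`, for
`1 ≤ y ≤ height`. -/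
structure Seed (L : Type*) where
  width : ℕ
  height : ℕ
  one_le_width : 1 ≤ width
  one_le_height : 1 ≤ height
  xAxis : ℕ → L
  yAxis : ℕ → L

/-- A set of tile types is directed if distinct tile types differ in their west labels or in
their south labels. -/
def Directed {L : Type*} (T : Finset (TileType L)) : Prop :=
  ∀ t₁ ∈ T, ∀ t₂ ∈ T, t₁ ≠ t₂ → t₁.west ≠ t₂.west ∨ t₁.south ≠ t₂.south

/-- A partial tiling of the plane: the tile type at a position, if that position is tiled. -/
abbrev Assembly (L : Type*) : Type _ := ℕ → ℕ → Option (TileType L)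

/-- The label that position `(x, y)`, `1 ≤ x`, receives from its west neighbor (a seed tile if
`x = 1`), if that neighbor is present. -/
def westInput {L : Type*} (σ : Seed L) (A : Assembly L) (x y : ℕ) : Option L :=
  if x = 1 then some (σ.yAxis y) else (A (x - 1) y).map TileType.east

/-- The label that position `(x, y)`, `1 ≤ y`, receives from its south neighbor (a seed tile if
`y = 1`), if that neighbor is present. -/
def southInput {L : Type*} (σ : Seed L) (A : Assembly L) (x y : ℕ) : Option L :=
  if y = 1 then some (σ.xAxis x) else (A x (y - 1)).map TileType.north

/-- The tiling rule: a tile of type `t ∈ T` can attach to the assembly `A` at the vacant position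
`(x, y)` of the domain delimited by the seed if and only if its west label matches the east label
of the tile at `(x - 1, y)` and its south label matches the north label of the tile at
`(x, y - 1)`. -/
def CanAttach {L : Type*} (T : Finset (TileType L)) (σ : Seed L) (A : Assembly L) (x y : ℕ)
    (t : TileType L) : Prop :=
  (1 ≤ x ∧ x ≤ σ.width) ∧ (1 ≤ y ∧ y ≤ σ.height) ∧ A x y = none ∧ t ∈ T ∧
    westInput σ A x y = some t.west ∧ southInput σ A x y = some t.south

/-- The assemblies that the RTAS `(T, σ)` can produce by attaching tiles one by one, starting from
the bare seed. -/
inductive Producible {L : Type*} (T : Finset (TileType L)) (σ : Seed L) : Assembly L → Prop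
  | seed : Producible T σ (fun _ _ => none)
  | attach (A : Assembly L) (x y : ℕ) (t : TileType L) : Producible T σ A →
      CanAttach T σ A x y t →
      Producible T σ (Function.update A x (Function.update (A x) y (some t)))

/-- `P` is a terminal pattern of the RTAS `(T, σ)`: some producible assembly tiles the whole
domain `{1, …, width} × {1, …, height}`, and `P` shows its colors. -/
def IsTerminalPattern {L : Type*} (T : Finset (TileType L)) (σ : Seed L)
    (P : Pattern σ.width σ.height) : Prop :=
  ∃ A : Assembly L, Producible T σ A ∧
    ∀ (x : Fin σ.width) (y : Fin σ.height), (A (x + 1) (y + 1)).map TileType.color = some (P x y)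

/-- The RTAS `(T, σ)` uniquely self-assembles `P`: `P` is its unique terminal pattern. -/
def UniquelySelfAssembles {L : Type*} (T : Finset (TileType L)) (σ : Seed L)
    (P : Pattern σ.width σ.height) : Prop :=
  IsTerminalPattern T σ P ∧ ∀ P' : Pattern σ.width σ.height, IsTerminalPattern T σ P' → P' = P

/-! ### Isomorphism of tile sets -/

/-- Rename the horizontal (west/east) labels by `f` and the vertical (north/south) ones by `g`. -/
def TileType.rename {L L' : Type*} (f g : L → L') (t : TileType L) : TileType L' :=
  ⟨g t.north, f t.west, g t.south, f t.east, t.color⟩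

/-- The labels that occur on west or east sides of tile types of `T`. -/
def horizontalLabels {L : Type*} (T : Finset (TileType L)) : Set L :=
  {l | ∃ t ∈ T, t.west = l ∨ t.east = l}

/-- The labels that occur on north or south sides of tile types of `T`. -/
def verticalLabels {L : Type*} (T : Finset (TileType L)) : Set L :=
  {l | ∃ t ∈ T, t.north = l ∨ t.south = l}

/-- `T'` is isomorphic to `T` modulo glue renaming: it arises from `T` by an injective renaming of
the horizontal labels and an injective renaming of the vertical labels.  (A west/east label is
never matched against a north/south label, so the two renamings are independent.) -/
def Isomorphic {L L' : Type*} (T : Finset (TileType L)) (T' : Finset (TileType L')) : Prop :=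
  ∃ f g : L → L', Set.InjOn f (horizontalLabels T) ∧ Set.InjOn g (verticalLabels T) ∧
    (TileType.rename f g) '' (T : Set (TileType L)) = (T' : Set (TileType L'))

/-! ### The tile set `Teval` -/

/-- The glues of `Teval`.  `F`, `T` are the upper-case Boolean glues, `f`, `t` the lower-case
ones, `s` is "satisfied", `c`, `n`, `v` are the column glues. -/
inductive Glue : Type
  | F | T | f | t | s | c | n | v
deriving DecidableEq

/-! The eleven colors. -/

abbrev cyan : ℕ := 0
abbrev CE : ℕ := 1
abbrev white : ℕ := 2
abbrev black : ℕ := 3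
abbrev dgnlWhite : ℕ := 4
abbrev dgnlBlack : ℕ := 5
abbrev init : ℕ := 6
abbrev sat : ℕ := 7
abbrev yellow : ℕ := 8
abbrev red : ℕ := 9
abbrev blue : ℕ := 10

open Glue in
/-- The 21 tile types of `Teval`, each given as north, west, south, east, color. -/
def tevalList : List (TileType Glue) :=
  [ ⟨F, F, F, F, cyan⟩, ⟨T, F, T, F, cyan⟩, ⟨F, T, F, T, cyan⟩, ⟨T, T, T, T, cyan⟩,
    ⟨F, f, F, f, CE⟩, ⟨F, f, T, s, CE⟩, ⟨F, s, F, s, CE⟩,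
    ⟨n, f, n, f, white⟩, ⟨n, t, n, t, white⟩,
    ⟨v, f, v, f, black⟩, ⟨v, t, v, t, black⟩,
    ⟨F, F, n, f, dgnlWhite⟩, ⟨F, T, n, t, dgnlWhite⟩,
    ⟨F, F, v, f, dgnlBlack⟩, ⟨T, T, v, t, dgnlBlack⟩,
    ⟨c, f, c, F, init⟩, ⟨c, t, c, T, init⟩,
    ⟨F, s, c, F, sat⟩,
    ⟨T, s, T, s, yellow⟩,
    ⟨c, F, c, f, red⟩,
    ⟨c, T, c, t, blue⟩ ]

/-- The tile set `Teval`. -/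
def Teval : Finset (TileType Glue) := tevalList.toFinset

theorem Teval_card : Teval.card = 21 := by decide

theorem Teval_directed : Directed Teval := by unfold Directed; decide

/-! ### The pattern `gadget`

`gadget` is the pattern that `Teval` assembles from an explicit seed. -/

/-- Assemble one row with tiles of `Teval`, from west to east: `w` is the glue exposed by the seed
on the west, the list consists of the glues exposed by the row below (from west to east).  The
result is `none` if the assembly gets stuck. -/
def assembleRow (w : Glue) : List Glue → Option (List (TileType Glue))
  | [] => some []
  | g :: gs =>
    match tevalList.find? (fun t => decide (t.west = w) && decide (t.south = g)) with
    | none => none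
    | some t =>
      match assembleRow t.east gs with
      | none => none
      | some ts => some (t :: ts)

/-- Assemble the rows from bottom to top with tiles of `Teval`, above the glue sequence `gs` of the
`x`-axis and to the east of a glue sequence of the `y`-axis (listed from bottom to top). -/
def assembleRows (gs : List Glue) : List Glue → Option (List (List (TileType Glue)))
  | [] => some []
  | w :: ws =>
    match assembleRow w gs with
    | none => none
    | some row =>
      match assembleRows (row.map TileType.north) ws with
      | none => none
      | some rows => some (row :: rows)

section Axes

open Glue

/-- The glues below the leftmost part of `gadget`: four columns, then the columns of `LB4`, the
top row of which is `Sat`, red, 2 `CE`, 3 yellow, 1 `CE`, 2 yellow, `k` `CE`, 1 yellow, 2 `CE`,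
`Sat`. -/
def leftGlues (k : ℕ) : List Glue :=
  [c, T, c, n] ++
    ([c, c] ++ [T, T] ++ [T, T, T] ++ [F] ++ [T, T] ++ List.replicate k F ++ [T] ++ [c, F] ++ [c])

/-- The glues below the middle part of `gadget`, to the east of `LB4`. -/
def middleGlues : List Glue := [n, v, c, c, n, c, T, c, c, c, n, c, c, n]

/-- The glues to the west of the leftmost and of the middle part: the rows of `LB4`, the rightmost
column of which is 2 red, `2 * r - 1` blue, `2 * r - 1` red, 2 blue, `Sat` (from bottom to top),
then one row of cyan, then the rows of the yellow stairs. -/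
def lowerGlues (r : ℕ) : List Glue :=
  ([F, s] ++ List.replicate (2 * r - 1) T ++ List.replicate (2 * r - 1) F ++ [T, T] ++ [s]) ++
    [s] ++ [s, f, f, f, f, f, f, f]

/-- Data of an instance of the diagonal template, 6 columns wide and 4 rows high: `column` is `n`
for `DGNL`-white on the diagonal and white below it, `v` for the black analogue; `b₁`, `b₂`, `b₃`,
`b₄` are the signals `F`/`T` (from bottom to top) that enter from the west and leave through the
rightmost column as red/blue. -/
structure TemplateInstance where
  column : Glue
  b₁ : Glue
  b₂ : Glue
  b₃ : Glue
  b₄ : Glue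

/-- The four template instances with prescribed column glue and two bottom signals. -/
def eighth (column b₁ b₂ : Glue) : List TemplateInstance :=
  [⟨column, b₁, b₂, T, T⟩, ⟨column, b₁, b₂, T, F⟩, ⟨column, b₁, b₂, F, T⟩, ⟨column, b₁, b₂, F, F⟩]

/-- The 32 template instances, in the order in which they are placed from southwest to northeast. -/
def templateInstances : List TemplateInstance :=
  eighth n F F ++ eighth n F T ++ eighth n T F ++ eighth n T T ++
    eighth v T T ++ eighth v T F ++ eighth v F T ++ eighth v F F

/-- The `x`-axis glues below a template instance: four diagonal columns, an `Init` column and a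
red/blue column, preceded by a padding column if the lowest signal is `T`. -/
def TemplateInstance.xGlues (i : TemplateInstance) : List Glue :=
  (if i.b₁ = F then [] else [i.column]) ++ List.replicate 4 i.column ++ [c, c]

/-- The `y`-axis glues for a template instance: its signals, and then two separating rows, which
are `s` for white instances and `f` for black ones.  A lowest signal `F` is not taken from the
seed, but from the `Sat` tile in the second of the separating rows below. -/
def TemplateInstance.yGlues (i : TemplateInstance) : List Glue :=
  (if i.b₁ = F then [] else [i.b₁]) ++ [i.b₂, i.b₃, i.b₄] ++
    List.replicate 2 (if i.column = n then s else f)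

/-- The glues on the `x`-axis (from west to east), with the constant `c` of `LB4` called `k`. -/
def gadgetX (k : ℕ) : List Glue :=
  leftGlues k ++ middleGlues ++ templateInstances.flatMap TemplateInstance.xGlues

/-- The glues on the `y`-axis (from bottom to top). -/
def gadgetY (r : ℕ) : List Glue :=
  lowerGlues r ++ templateInstances.flatMap TemplateInstance.yGlues

end Axes

/-- The constants of `LB4` are `c = 25` and `r = 13`. -/
def gadgetXAxis : List Glue := gadgetX 25

def gadgetYAxis : List Glue := gadgetY 13

/-- The assembly by `Teval` above these glues does not get stuck. -/
theorem assembleRows_gadget_isSome : (assembleRows gadgetXAxis gadgetYAxis).isSome = true := by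
  decide +kernel

/-- The rows of tiles (from bottom to top) that show the pattern `gadget`. -/
def gadgetRows : List (List (TileType Glue)) :=
  (assembleRows gadgetXAxis gadgetYAxis).get assembleRows_gadget_isSome

theorem length_of_assembleRow {w : Glue} {gs : List Glue} {ts : List (TileType Glue)}
    (h : assembleRow w gs = some ts) : ts.length = gs.length := by
  induction gs generalizing w ts with
  | nil => simp_all [assembleRow]
  | cons g gs ih =>
    simp only [assembleRow] at h
    split at h
    · cases h
    · split at h
      · cases h
      · rename_i ts' h'
        cases h
        simp [ih h']

theorem length_of_assembleRows {gs ws : List Glue} {rows : List (List (TileType Glue))}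
    (h : assembleRows gs ws = some rows) :
    rows.length = ws.length ∧ ∀ row ∈ rows, row.length = gs.length := by
  induction ws generalizing gs rows with
  | nil => simp_all [assembleRows]
  | cons w ws ih =>
    simp only [assembleRows] at h
    split at h
    · cases h
    · rename_i row hrow
      split at h
      · cases h
      · rename_i rows' h'
        cases h
        have := ih h'
        have hl := length_of_assembleRow hrow
        simp_all

theorem gadgetXAxis_length : gadgetXAxis.length = 265 := by decide +kernel

theorem gadgetYAxis_length : gadgetYAxis.length = 240 := by decide +kernel

theorem assembleRows_gadget : assembleRows gadgetXAxis gadgetYAxis = some gadgetRows := by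
  simp [gadgetRows]

theorem gadgetRows_length : gadgetRows.length = 240 :=
  (length_of_assembleRows assembleRows_gadget).1.trans gadgetYAxis_length

theorem gadgetRows_getElem_length (y : ℕ) (hy : y < gadgetRows.length) :
    gadgetRows[y].length = 265 :=
  ((length_of_assembleRows assembleRows_gadget).2 _ (List.getElem_mem hy)).trans gadgetXAxis_length

/-- The tile of `Teval` in column `x` and row `y` of `gadget` (both counted from 0). -/
def gadgetTile (x : Fin 265) (y : Fin 240) : TileType Glue :=
  (gadgetRows[(y : ℕ)]'(by rw [gadgetRows_length]; exact y.2))[(x : ℕ)]'(by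
    rw [gadgetRows_getElem_length]; exact x.2)

/-- The pattern `gadget`, of width 265 and height 240. -/
def gadget : Pattern 265 240 := fun x y => (gadgetTile x y).color

end RTAS

/-! A terminal assembly restricts to a tiling of the cells of `gadget` by tiles of `T` with matching
labels on adjacent cells; the labels entering at the border of the gadget are arbitrary. By
directedness a tile is determined by its west and south labels, so a column or row acts as a finite
automaton fed by its neighbors. For `T.card ≤ 21`, the number of tiles of each color is bounded from
below until nothing is to spare, and then all labels are reconstructed.

Part of the bounds is pigeonhole. If the inputs of a run of 25 cells of one color are constant or
periodic, the run is the orbit of a finite state; since the run ends, no state repeats, so there are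
at least 25 states (`le_card_of_autonomous`, `column_le`, `init_column_le`). If at most two tiles
fill a column or row, then either their output labels in its direction differ, and the sequence has
period 2 (`two_periodic`), or all these labels are equal and carry no information
(`eq_of_not_injOn`). This gives two tiles each of Init, white and black, and three of cyan. Since 16
diagonals show all words of four bits, it also gives a third white (black) tile if there is just one
DGNL tile of that kind (`diagonal_le_of_card_le`).

The other bounds come from exhaustive searches, evaluated in the kernel. `run` names the tiles at
selected cells, each by an old name of the same color or by a new name, and merges labels of
adjacent sides. A case is void if two names share both west and south labels, or if a new name
exceeds the budget left by the known bounds. Such searches refute three tiles of CE and yellow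
together, a single DGNL-white, a single DGNL-black, and three cyan tiles. The lower bounds then add
up to 21.

A last search leaves only states with 21 names in which all labels that are equal in `Teval` are
equal. This yields renamings from `Teval` onto `T`; they are injective because merging two labels
would give two tiles of `T` with the same west and south labels (`isomorphic_of_interp`). -/

namespace RTAS

/-! ### A script-driven case analysis on partial tilings -/

/-- `force n k` is `k n`, with `n` evaluated first. -/
def force {α : Type} (n : ℕ) (k : ℕ → α) : α :=
  Nat.rec (k 0) (fun p _ => k (Nat.succ p)) n

/-- Join the classes of `L` that meet the mask `m₀` with the mask `m`. -/
def joinClasses (m₀ : ℕ) (k : ℕ → List ℕ → Bool) (L : List ℕ) : ℕ → List ℕ → Bool :=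
  List.rec (motive := fun _ => ℕ → List ℕ → Bool) (fun m acc => k m acc)
    (fun h _ ih m acc =>
      -- `Bool.rec` lists the `false` case first: a class meeting `m₀` is absorbed into `m`, any
      -- other is kept in `acc`.
      Bool.rec (force (Nat.lor m h) fun m' => ih m' acc) (ih m (h :: acc))
        (Nat.beq (Nat.land m₀ h) 0)) L

/-- Two names share the class `m` and a class of the list `L` of classes of the other direction. -/
def clashes (m : ℕ) (L : List ℕ) : Bool :=
  List.rec false (fun v _ ih =>
    -- Reduction modulo $2^{32}$ keeps the nodes of west or south sides. Masking with the
    -- predecessor clears the lowest bit, so the test asks for at most one common node.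
    force (Nat.mod (Nat.land m v) 4294967296) fun x =>
      Bool.rec true ih (Nat.beq (Nat.land x (Nat.pred x)) 0)) L

/-- Unless `a = 0`, identify the nodes of the mask `m₀` in the classes `L`.  The result is `fail`
if this identifies two names in view of the classes `L'` of the other direction. -/
def identify (fail : Bool) (a : ℕ) (m₀ : ℕ) (L L' : List ℕ) (k : List ℕ → Bool) : Bool :=
  Nat.rec (k L) (fun _ _ =>
    force m₀ fun m₀ =>
      -- The joined class starts as `m₀` itself, so a node in no class of `L` counts as a singleton.
      joinClasses m₀ (fun m acc => Bool.rec (k (m :: acc)) fail (clashes m L')) L m₀ []) a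

/-- The mask of the nodes `i` and `32 + j`. -/
def edge (i j : ℕ) : ℕ := Nat.lor (Nat.pow 2 i) (Nat.pow 2 (Nat.add 32 j))

/-- Give the current position the name `u`, its west, south, east and north neighbors having the
names `w`, `s`, `e`, `n` (`0` if they are not named). -/
def tryName (w s e n : ℕ) (H V : List ℕ) (u : ℕ) (k : List ℕ → List ℕ → Bool) (fail : Bool) :
    Bool :=
  identify fail w (edge u w) H V fun H =>
  identify fail e (edge e u) H V fun H =>
  identify fail s (edge u s) V H fun V =>
  identify fail n (edge n u) V H fun V => k H V

/-- Try the names of color `c` one after the other. -/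
def tryNames (c : ℕ) (f : ℕ → ℕ → (ℕ → Bool) → Bool) (g : ℕ → Bool) (cols : List ℕ) : ℕ → Bool :=
  List.rec (motive := fun _ => ℕ → Bool) g (fun d _ ih r =>
    -- An entry of `cols` is a color plus 16 times a name. The remaining names are passed to `f` as
    -- a continuation, so all cases read from one script.
    Bool.rec (ih r) (force (Nat.div d 16) fun u => f u r ih) (Nat.beq (Nat.mod d 16) c)) cols

/-- The name of position `j` (`0` if it is not named). -/
def nameAt (A j : ℕ) : ℕ := Nat.mod (Nat.shiftRight A (Nat.mul 5 j)) 32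

/-- Digit `i` of an entry of a table of positions. -/
def neighbor (e i : ℕ) : ℕ := Nat.mod (Nat.shiftRight e i) 1024

/-- Entry `j` of a table of positions. -/
def entry (table j : ℕ) : ℕ :=
  -- The modulus is $2^{96}$. An entry holds the color in its lowest bits, the west, south, east and
  -- north neighbors from bits 8, 20, 32 and 44 on, and the column and row from bits 56 and 72 on.
  -- Index 0 means that there is no such neighbor.
  Nat.mod (Nat.shiftRight table (Nat.mul 96 j)) 79228162514264337593543950336

/-- The type of procedures that take the names `A` of positions, the number `n` of names, the
packed numbers `P` of names of each color, the list of names with their colors, the classes of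
horizontal and of vertical labels, a script, and what is to be done with the rest of the script. -/
abbrev Search : Type := ℕ → ℕ → ℕ → List ℕ → List ℕ → List ℕ → ℕ → (ℕ → Bool) → Bool

/-- Name the position given by the first entry of the script `s` in all possible ways, and go on
with `ih`. -/
def step (table : ℕ) (bud : ℕ → Bool) (final : List ℕ → List ℕ → List ℕ → Bool) (ih : Search) :
    Search := fun A n P cols H V s k =>
  -- The unread part of the script must be nonzero: its top digit is a sentinel that is never
  -- consumed.
  Nat.rec false (fun r' _ =>
    force (Nat.mod s 1024) fun j =>
    Nat.rec (Bool.rec false (k (Nat.succ r')) (final cols H V)) (fun _ _ =>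
      Bool.rec false
      (force (entry table j) fun e =>
      Nat.rec false (fun _ _ =>
      force (Nat.mod e 16) fun c =>
      force (nameAt A (neighbor e 8)) fun aw =>
      force (nameAt A (neighbor e 20)) fun as =>
      force (nameAt A (neighbor e 32)) fun ae =>
      force (nameAt A (neighbor e 44)) fun an =>
      -- The old names of color `c` come first, then the name `n + 1`. A case closed by a clash
      -- reads nothing from the script and hands it on to the next case.
      tryNames c
        (fun u r k => tryName aw as ae an H V u (fun H V =>
          force (Nat.lor A (Nat.shiftLeft u (Nat.mul 5 j))) fun A =>
            ih A n P cols H V r k) (k r))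
        (fun r =>
          force (Nat.add P (Nat.pow 256 c)) fun P =>
          -- If the budget excludes one more tile of color `c`, the case of a new name is void.
          Bool.rec (k r)
            (force (Nat.succ n) fun n =>
              tryName aw as ae an H V n (fun H V =>
                force (Nat.lor A (Nat.shiftLeft n (Nat.mul 5 j))) fun A =>
                force (Nat.add c (Nat.mul 16 n)) fun d =>
                  ih A n P (d :: cols) H V r k) (k r))
            (bud P))
        cols (Nat.succ r')) e)
      (Nat.beq (nameAt A j) 0)) j)
    (Nat.div s 1024)

/-- Go through the cases for the names of positions in the order given by the script, whose
digits in base 1024 refer to positions.  Entry `j` of `table` holds the color of position `j` and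
the indices of its neighbors.  At the digit `0` the state has to pass the test `final`. -/
def run (table : ℕ) (bud : ℕ → Bool) (final : List ℕ → List ℕ → List ℕ → Bool) (fuel : ℕ) :
    Search :=
  Nat.rec (motive := fun _ => Search) (fun _ _ _ _ _ _ _ _ => false)
    (fun _ ih => step table bud final ih) fuel

/-- Digit `c` in base 256. -/
def digit (P c : ℕ) : ℕ := Nat.mod (Nat.div P (Nat.pow 256 c)) 256

/-! ### Soundness of the case analysis -/

variable {L : Type*}

theorem force_eq {α : Type} (n : ℕ) (k : ℕ → α) : force n k = k n := by
  cases n <;> rfl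

/-- Every class in `C` consists of nodes of the names `1, …, n` with the same label. -/
def ClassesOk {L : Type*} (lab : ℕ → L) (n : ℕ) (C : List ℕ) : Prop :=
  ∀ m ∈ C, ∀ i, m.testBit i = true → (1 ≤ i % 32 ∧ i % 32 ≤ n) ∧ i < 64 ∧
    ∀ j, m.testBit j = true → lab i = lab j

theorem ClassesOk.cons {lab : ℕ → L} {n m : ℕ} {C : List ℕ} (h₁ : ClassesOk lab n [m])
    (h : ClassesOk lab n C) : ClassesOk lab n (m :: C) := by
  intro m' hm'
  rcases List.mem_cons.1 hm' with rfl | hm'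
  · exact h₁ _ (List.mem_singleton.2 rfl)
  · exact h _ hm'

theorem exists_common_bit {a b : ℕ} (h : a &&& b ≠ 0) :
    ∃ i, a.testBit i = true ∧ b.testBit i = true := by
  obtain ⟨i, hi⟩ := Nat.exists_testBit_of_ne_zero h
  rw [Nat.testBit_and, Bool.and_eq_true] at hi
  exact ⟨i, hi⟩

/-- If `i` were the only bit, `x` would be `2 ^ i`, whose predecessor has only lower bits. -/
theorem exists_two_bits {x : ℕ} (h : x &&& (x - 1) ≠ 0) :
    ∃ i j, i ≠ j ∧ x.testBit i = true ∧ x.testBit j = true := by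
  have hx : x ≠ 0 := by rintro rfl; simp at h
  obtain ⟨i, hi⟩ := Nat.exists_testBit_of_ne_zero hx
  by_contra! hc
  have : x = 2 ^ i := by
    apply Nat.eq_of_testBit_eq
    intro j
    rw [Nat.testBit_two_pow]
    by_cases hij : i = j
    · subst hij; simpa using hi
    · have := hc i j hij hi
      simpa [hij] using this
  subst this
  apply h
  rw [Nat.and_two_pow_sub_one_eq_mod, Nat.mod_self]

/-- Since `m₀` stays inside `m`, a class that meets `m₀` has a node in common with `m`, hence the
same label. That `k` is reached holds for any labels; only correctness of the classes needs the
premises of the inner implication. -/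
theorem joinClasses_sound {lab : ℕ → L} {n m₀ : ℕ} {k : ℕ → List ℕ → Bool} {C : List ℕ} :
    ∀ {m : ℕ} {acc : List ℕ}, joinClasses m₀ k C m acc = true →
      ∃ m' acc', k m' acc' = true ∧ (ClassesOk lab n C → ClassesOk lab n acc →
        ClassesOk lab n [m] → (∀ i, m₀.testBit i = true → m.testBit i = true) →
          ClassesOk lab n acc' ∧ ClassesOk lab n [m']) := by
  induction C with
  | nil => exact fun h => ⟨_, _, h, fun _ h₁ h₂ _ => ⟨h₁, h₂⟩⟩
  | cons v C ih =>
    intro m acc h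
    have hs : ClassesOk lab n (v :: C) → ClassesOk lab n [v] ∧ ClassesOk lab n C := fun h =>
      ⟨fun x hx => h x (by simp_all), fun x hx => h x (by simp_all)⟩
    change Bool.rec (force (Nat.lor m v) fun m' => joinClasses m₀ k C m' acc)
      (joinClasses m₀ k C m (v :: acc)) (Nat.beq (Nat.land m₀ v) 0) = true at h
    cases hb : Nat.beq (Nat.land m₀ v) 0 with
    | true =>
      rw [hb] at h
      obtain ⟨m', acc', h₁, h₂⟩ := ih h
      exact ⟨m', acc', h₁, fun hC ha hm h₀ => h₂ (hs hC).2 ((hs hC).1.cons ha) hm h₀⟩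
    | false =>
      rw [hb] at h
      simp only [force_eq] at h
      obtain ⟨m', acc', h₁, h₂⟩ := ih h
      refine ⟨m', acc', h₁, fun hC ha hm h₀ => h₂ (hs hC).2 ha ?_ ?_⟩
      · obtain ⟨l, hl₀, hlv⟩ := exists_common_bit (Nat.ne_of_beq_eq_false hb)
        have hlm := h₀ l hl₀
        have e₁ : ∀ i, m.testBit i = true → lab i = lab l := fun i hi =>
          (hm m (by simp) i hi).2.2 l hlm
        have e₂ : ∀ i, v.testBit i = true → lab i = lab l := fun i hi =>
          ((hs hC).1 v (by simp) i hi).2.2 l hlv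
        have e : ∀ i, (m ||| v).testBit i = true → lab i = lab l := fun i hi => by
          rw [Nat.testBit_or, Bool.or_eq_true] at hi
          exact hi.elim (e₁ i) (e₂ i)
        intro x hx i hi
        obtain rfl : x = m ||| v := List.mem_singleton.1 hx
        have hi' := hi
        rw [Nat.testBit_or, Bool.or_eq_true] at hi'
        have hb : (1 ≤ i % 32 ∧ i % 32 ≤ n) ∧ i < 64 := hi'.elim
          (fun hi => ⟨(hm m (by simp) i hi).1, (hm m (by simp) i hi).2.1⟩)
          (fun hi => ⟨((hs hC).1 v (by simp) i hi).1, ((hs hC).1 v (by simp) i hi).2.1⟩)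
        exact ⟨hb.1, hb.2, fun j hj => (e i hi).trans (e j hj).symm⟩
      · intro i hi
        change (m ||| v).testBit i = true
        simp [Nat.testBit_or, h₀ i hi]

/-- No two names share a label on the west and a label on the south. -/
theorem clashes_false {lab lab' : ℕ → L} {n m : ℕ} {C : List ℕ}
    (hinj : ∀ u v, 1 ≤ u → u ≤ n → 1 ≤ v → v ≤ n → lab u = lab v → lab' u = lab' v → u = v)
    (hm : ClassesOk lab n [m]) (hC : ClassesOk lab' n C) : clashes m C = false := by
  induction C with
  | nil => rfl
  | cons v C ih =>
    change force (Nat.mod (Nat.land m v) 4294967296) (fun x =>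
      Bool.rec true (clashes m C) (Nat.beq (Nat.land x (Nat.pred x)) 0)) = false
    rw [force_eq, ih fun x hx => hC x (by simp_all)]
    cases hb : Nat.beq (Nat.land (Nat.mod (Nat.land m v) 4294967296)
      (Nat.pred (Nat.mod (Nat.land m v) 4294967296))) 0 with
    | true => rfl
    | false =>
      obtain ⟨i, j, hij, hi, hj⟩ := exists_two_bits (Nat.ne_of_beq_eq_false hb)
      have key : ∀ i, ((m &&& v) % 2 ^ 32).testBit i = true →
          i < 32 ∧ m.testBit i = true ∧ v.testBit i = true := fun i hi => by
        rw [Nat.testBit_mod_two_pow, Nat.testBit_and] at hi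
        simpa using hi
      obtain ⟨i₁, i₂, i₃⟩ := key i hi
      obtain ⟨j₁, j₂, j₃⟩ := key j hj
      have a := hm m (by simp) i i₂
      have b := hC v (by simp) i i₃
      have a' := hm m (by simp) j j₂
      rw [Nat.mod_eq_of_lt i₁] at a
      rw [Nat.mod_eq_of_lt j₁] at a'
      exact absurd (hinj i j a.1.1 a.1.2 a'.1.1 a'.1.2 (a.2.2 j j₂) (b.2.2 j j₃)) hij

theorem identify_succ {fail : Bool} {a m₀ : ℕ} {C C' : List ℕ} {k : List ℕ → Bool} :
    identify fail (a + 1) m₀ C C' k = joinClasses m₀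
      (fun m acc => Bool.rec (k (m :: acc)) fail (clashes m C')) C m₀ [] := by
  simp only [identify, force_eq]

/-- Meant for cases that do not occur in the given tiling, where nothing is known about the classes:
even there, success passes through `fail` or `k`, so the cases further down the script have been
checked. -/
theorem identify_progress {fail : Bool} {a m₀ : ℕ} {C C' : List ℕ} {k : List ℕ → Bool}
    (h : identify fail a m₀ C C' k = true) : fail = true ∨ ∃ D, k D = true := by
  cases a with
  | zero => exact .inr ⟨_, h⟩
  | succ a =>
    rw [identify_succ] at h
    obtain ⟨m, acc, h, -⟩ := joinClasses_sound (lab := id) (n := 0) h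
    cases hc : clashes m C' with
    | true => rw [hc] at h; exact .inl h
    | false => rw [hc] at h; exact .inr ⟨_, h⟩

theorem edge_testBit (i j l : ℕ) : (edge i j).testBit l = true ↔ l = i ∨ l = 32 + j := by
  change ((2 ^ i ||| 2 ^ (32 + j)).testBit l) = true ↔ _
  rw [Nat.testBit_or, Bool.or_eq_true, Nat.testBit_two_pow, Nat.testBit_two_pow]
  simp [eq_comm]

/-- An identification of labels that are equal in reality produces no clash, so the evaluation must
have gone on with `k`. -/
theorem identify_sound {lab lab' : ℕ → L} {n : ℕ} {fail : Bool} {a i j : ℕ} {C C' : List ℕ}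
    {k : List ℕ → Bool}
    (hinj : ∀ u v, 1 ≤ u → u ≤ n → 1 ≤ v → v ≤ n → lab u = lab v → lab' u = lab' v → u = v)
    (hC : ClassesOk lab n C) (hC' : ClassesOk lab' n C') (hn : n < 32)
    (he : a ≠ 0 → (1 ≤ i ∧ i ≤ n) ∧ (1 ≤ j ∧ j ≤ n) ∧ lab i = lab (32 + j))
    (h : identify fail a (edge i j) C C' k = true) :
    ∃ D, ClassesOk lab n D ∧ k D = true := by
  cases a with
  | zero => exact ⟨_, hC, h⟩
  | succ a =>
    obtain ⟨hi, hj, hij⟩ := he (by simp)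
    rw [identify_succ] at h
    obtain ⟨m, acc, h, h'⟩ := joinClasses_sound (lab := lab) (n := n) h
    have h' := h' hC (fun _ h => by simp at h) (by
      intro x hx l hl
      obtain rfl := List.mem_singleton.1 hx
      have key : ∀ l, (edge i j).testBit l = true →
          ((1 ≤ l % 32 ∧ l % 32 ≤ n) ∧ l < 64) ∧ lab l = lab i := by
        intro l hl
        rcases (edge_testBit i j l).1 hl with rfl | rfl
        · exact ⟨⟨by omega, by omega⟩, rfl⟩
        · exact ⟨⟨by omega, by omega⟩, hij.symm⟩
      exact ⟨(key l hl).1.1, (key l hl).1.2, fun j hj => (key l hl).2.trans (key j hj).2.symm⟩)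
      fun i hi => hi
    rw [clashes_false hinj h'.2 hC'] at h
    exact ⟨_, h'.2.cons h'.1, h⟩

theorem tryName_progress {w s e n u : ℕ} {H V : List ℕ} {k : List ℕ → List ℕ → Bool}
    {fail : Bool} (h : tryName w s e n H V u k fail = true) :
    fail = true ∨ ∃ H V, k H V = true := by
  rcases identify_progress h with h | ⟨H₁, h⟩
  · exact .inl h
  rcases identify_progress h with h | ⟨H₂, h⟩
  · exact .inl h
  rcases identify_progress h with h | ⟨V₁, h⟩
  · exact .inl h
  rcases identify_progress h with h | ⟨V₂, h⟩
  · exact .inl h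
  exact .inr ⟨_, _, h⟩

/-- By `hf`, a successful case hands over to its continuation, which is the rest of the loop. So
success means that every entry of color `c` and finally `g` has been run through. -/
theorem tryNames_sound {c : ℕ} {f : ℕ → ℕ → (ℕ → Bool) → Bool} {g : ℕ → Bool}
    (hf : ∀ u r k, f u r k = true → ∃ r, k r = true) {cols : List ℕ} :
    ∀ {r : ℕ}, tryNames c f g cols r = true → (∃ r, g r = true) ∧
      ∀ d ∈ cols, d % 16 = c → ∃ r k, f (d / 16) r k = true := by
  induction cols with
  | nil => exact fun h => ⟨⟨_, h⟩, by simp⟩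
  | cons d cols ih =>
    intro r h
    change Bool.rec (tryNames c f g cols r) (force (Nat.div d 16) fun u =>
      f u r (tryNames c f g cols)) (Nat.beq (Nat.mod d 16) c) = true at h
    rw [force_eq] at h
    cases hb : Nat.beq (Nat.mod d 16) c with
    | false =>
      rw [hb] at h
      refine ⟨(ih h).1, fun d' hd' hc => ?_⟩
      rcases List.mem_cons.1 hd' with rfl | hd'
      · exact absurd hc (Nat.ne_of_beq_eq_false hb)
      · exact (ih h).2 d' hd' hc
    | true =>
      rw [hb] at h
      obtain ⟨r', hr'⟩ := hf _ _ _ h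
      refine ⟨(ih hr').1, fun d' hd' hc => ?_⟩
      rcases List.mem_cons.1 hd' with rfl | hd'
      · exact ⟨_, _, h⟩
      · exact (ih hr').2 d' hd' hc

/-- The five bits at `j` are zero before, and `u` fits into them without spilling over. -/
theorem nameAt_lor {A j u : ℕ} (h : nameAt A j = 0) (hu : u < 32) (i : ℕ) :
    nameAt (A ||| u <<< (5 * j)) i = if i = j then u else nameAt A i := by
  have key : ∀ A i, nameAt A i = (A >>> (5 * i)) % 2 ^ 5 := fun _ _ => rfl
  simp only [key] at h ⊢
  have hu' : ∀ b, 5 ≤ b → u.testBit b = false := fun b hb =>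
    Nat.testBit_lt_two_pow (hu.trans_le (Nat.pow_le_pow_right (n := 2) (by norm_num) hb))
  split_ifs with hij
  · subst hij
    apply Nat.eq_of_testBit_eq
    intro b
    have := congrArg (fun x => x.testBit b) h
    simp only [Nat.testBit_mod_two_pow, Nat.testBit_shiftRight, Nat.zero_testBit] at this
    rw [Nat.testBit_mod_two_pow, Nat.testBit_shiftRight, Nat.testBit_or, Nat.testBit_shiftLeft]
    by_cases hb : b < 5
    · simp only [hb, decide_true, Bool.true_and] at this
      simp [hb, this]
    · simp [hb, hu' b (by omega)]
  · apply Nat.eq_of_testBit_eq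
    intro b
    rw [Nat.testBit_mod_two_pow, Nat.testBit_shiftRight, Nat.testBit_or, Nat.testBit_shiftLeft,
      Nat.testBit_mod_two_pow, Nat.testBit_shiftRight]
    by_cases hb : b < 5
    · rcases lt_or_ge (5 * i + b) (5 * j) with h | h
      · simp [show ¬ 5 * i + b ≥ 5 * j by omega]
      · simp [hu' (5 * i + b - 5 * j) (by omega)]
    · simp [hb]

/-- `τ` places tiles of `T` at the positions listed in `table`. -/
structure Placed (T : Finset (TileType L)) (table : ℕ) (τ : ℕ → TileType L) : Prop where
  mem : ∀ j < 1024, entry table j ≠ 0 → τ j ∈ T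
  color : ∀ j < 1024, entry table j ≠ 0 → (τ j).color = entry table j % 16
  west : ∀ j < 1024, neighbor (entry table j) 8 ≠ 0 →
    (τ (neighbor (entry table j) 8)).east = (τ j).west
  south : ∀ j < 1024, neighbor (entry table j) 20 ≠ 0 →
    (τ (neighbor (entry table j) 20)).north = (τ j).south
  east : ∀ j < 1024, neighbor (entry table j) 32 ≠ 0 →
    (τ j).east = (τ (neighbor (entry table j) 32)).west
  north : ∀ j < 1024, neighbor (entry table j) 44 ≠ 0 →
    (τ j).north = (τ (neighbor (entry table j) 44)).south

/-- The horizontal label at a node. -/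
def labH (ν : ℕ → TileType L) (i : ℕ) : L := if i < 32 then (ν i).west else (ν (i - 32)).east

/-- The vertical label at a node. -/
def labV (ν : ℕ → TileType L) (i : ℕ) : L := if i < 32 then (ν i).south else (ν (i - 32)).north

/-- The list of the colors of the names `n, …, 1`. -/
def colorList (κ : ℕ → ℕ) : ℕ → List ℕ
  | 0 => []
  | n + 1 => (κ (n + 1) + 16 * (n + 1)) :: colorList κ n

/-- The packed numbers of names of each color. -/
def colorCount (κ : ℕ → ℕ) : ℕ → ℕ
  | 0 => 0
  | n + 1 => colorCount κ n + 256 ^ κ (n + 1)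

theorem mem_colorList {κ : ℕ → ℕ} {n u : ℕ} (h₁ : 1 ≤ u) (h₂ : u ≤ n) :
    κ u + 16 * u ∈ colorList κ n := by
  induction n with
  | zero => omega
  | succ n ih =>
    rw [colorList]
    rcases Nat.lt_or_ge n u with h | h
    · obtain rfl : u = n + 1 := by omega
      simp
    · exact List.mem_cons_of_mem _ (ih h)

theorem colorList_congr {κ κ' : ℕ → ℕ} {n : ℕ} (h : ∀ u, 1 ≤ u → u ≤ n → κ u = κ' u) :
    colorList κ n = colorList κ' n := by
  induction n with
  | zero => rfl
  | succ n ih =>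
    rw [colorList, colorList, ih fun u h₁ h₂ => h u h₁ (by omega), h (n + 1) (by omega) le_rfl]

theorem colorCount_congr {κ κ' : ℕ → ℕ} {n : ℕ} (h : ∀ u, 1 ≤ u → u ≤ n → κ u = κ' u) :
    colorCount κ n = colorCount κ' n := by
  induction n with
  | zero => rfl
  | succ n ih =>
    rw [colorCount, colorCount, ih fun u h₁ h₂ => h u h₁ (by omega), h (n + 1) (by omega) le_rfl]

/-- The names `1, …, n` stand for distinct tiles `ν 1, …, ν n` of `T`. -/
structure Naming (T : Finset (TileType L)) (n : ℕ) (ν : ℕ → TileType L) : Prop where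
  mem : ∀ u, 1 ≤ u → u ≤ n → ν u ∈ T
  inj : ∀ u v, 1 ≤ u → u ≤ n → 1 ≤ v → v ≤ n → ν u = ν v → u = v
  color : ∀ u, 1 ≤ u → u ≤ n → (ν u).color < 16

theorem Naming.le_card {T : Finset (TileType L)} {n : ℕ} {ν : ℕ → TileType L}
    (h : Naming T n ν) : n ≤ T.card := by
  have : (Finset.Icc 1 n).card ≤ T.card := Finset.card_le_card_of_injOn ν
    (fun u hu => h.mem u (Finset.mem_Icc.1 hu).1 (Finset.mem_Icc.1 hu).2)
    (fun u hu v hv => by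
      have hu := Finset.mem_Icc.1 hu
      have hv := Finset.mem_Icc.1 hv
      exact h.inj u v hu.1 hu.2 hv.1 hv.2)
  simpa using this

/-- The state of the case analysis is correct for the names `ν`. -/
structure Interp (T : Finset (TileType L)) (τ : ℕ → TileType L) (A n P : ℕ)
    (cols H V : List ℕ) (ν : ℕ → TileType L) : Prop where
  naming : Naming T n ν
  zero : nameAt A 0 = 0
  name : ∀ j, nameAt A j ≠ 0 → nameAt A j ≤ n ∧ τ j = ν (nameAt A j)
  count : P = colorCount (fun u => (ν u).color) n
  cols_eq : cols = colorList (fun u => (ν u).color) n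
  classesH : ClassesOk (labH ν) n H
  classesV : ClassesOk (labV ν) n V

theorem ClassesOk.mono {lab lab' : ℕ → L} {n n' : ℕ} {C : List ℕ} (h : ClassesOk lab n C)
    (hn : n ≤ n') (hlab : ∀ i, 1 ≤ i % 32 → i % 32 ≤ n → i < 64 → lab i = lab' i) :
    ClassesOk lab' n' C := fun m hm i hi => by
  obtain ⟨h₁, h₂, h₃⟩ := h m hm i hi
  refine ⟨⟨h₁.1, h₁.2.trans hn⟩, h₂, fun j hj => ?_⟩
  obtain ⟨h₁', h₂', -⟩ := h m hm j hj
  rw [← hlab i h₁.1 h₁.2 h₂, ← hlab j h₁'.1 h₁'.2 h₂', h₃ j hj]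

/-- The classes mention no name beyond `n`, so giving `t` the name `n + 1` disturbs none of them. -/
theorem Interp.extend {T : Finset (TileType L)} {τ : ℕ → TileType L} {A n P : ℕ}
    {cols H V : List ℕ} {ν : ℕ → TileType L} (h : Interp T τ A n P cols H V ν) (hn : n < 31)
    {t : TileType L} (ht : t ∈ T) (hc : t.color < 16) (hnew : ∀ u, 1 ≤ u → u ≤ n → t ≠ ν u) :
    Interp T τ A (n + 1) (P + 256 ^ t.color) ((t.color + 16 * (n + 1)) :: cols) H V
      (Function.update ν (n + 1) t) := by
  have hne : ∀ u, u ≤ n → Function.update ν (n + 1) t u = ν u := fun u hu =>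
    Function.update_of_ne (by omega) _ _
  have hlt : ∀ u, u ≤ n + 1 → u ≠ n + 1 → u ≤ n := fun u h₁ h₂ => by omega
  refine ⟨⟨fun u h₁ h₂ => ?_, fun u v h₁ h₂ h₃ h₄ => ?_, fun u h₁ h₂ => ?_⟩, h.zero,
    fun j hj => ?_, ?_, ?_, h.classesH.mono (by omega) ?_, h.classesV.mono (by omega) ?_⟩
  · by_cases hu : u = n + 1
    · subst hu; simpa using ht
    · rw [hne u (hlt u h₂ hu)]; exact h.naming.mem u h₁ (hlt u h₂ hu)
  · by_cases hu : u = n + 1 <;> by_cases hv : v = n + 1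
    · simp [hu, hv]
    · subst hu
      rw [hne v (hlt v h₄ hv), Function.update_self]
      exact fun h' => absurd h' (hnew v h₃ (hlt v h₄ hv))
    · subst hv
      rw [hne u (hlt u h₂ hu), Function.update_self]
      exact fun h' => absurd h'.symm (hnew u h₁ (hlt u h₂ hu))
    · rw [hne u (hlt u h₂ hu), hne v (hlt v h₄ hv)]
      exact h.naming.inj u v h₁ (hlt u h₂ hu) h₃ (hlt v h₄ hv)
  · by_cases hu : u = n + 1
    · subst hu; simpa using hc
    · rw [hne u (hlt u h₂ hu)]; exact h.naming.color u h₁ (hlt u h₂ hu)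
  · rw [hne _ (h.name j hj).1]
    exact ⟨(h.name j hj).1.trans (by omega), (h.name j hj).2⟩
  · rw [colorCount, h.count, Function.update_self,
      colorCount_congr (κ := fun u => (ν u).color)
        (κ' := fun u => (Function.update ν (n + 1) t u).color) fun u _ hu => by simp only [hne u hu]]
  · rw [colorList, h.cols_eq, Function.update_self,
      colorList_congr (κ := fun u => (ν u).color)
        (κ' := fun u => (Function.update ν (n + 1) t u).color) fun u _ hu => by simp only [hne u hu]]
  all_goals
    intro i h₁ h₂ h₃
    simp only [labH, labV]
    split_ifs
    · rw [hne i (by omega)]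
    · rw [hne (i - 32) (by omega)]

/-- For the true name of the tile at `j`, the four identifications are equalities between sides that
touch in the tiling; directedness excludes clashes among them. -/
theorem Interp.place {T : Finset (TileType L)} {table : ℕ} {τ : ℕ → TileType L}
    (hT : Directed T) (hτ : Placed T table τ) {A n P : ℕ} {cols H V : List ℕ}
    {ν : ℕ → TileType L} (h : Interp T τ A n P cols H V ν) (hn : n < 32) {j u : ℕ}
    (hj : j < 1024) (hj₀ : j ≠ 0) (hA : nameAt A j = 0) (hu₁ : 1 ≤ u) (hu : u ≤ n)
    (hju : τ j = ν u) {k : List ℕ → List ℕ → Bool} {fail : Bool}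
    (ht : tryName (nameAt A (neighbor (entry table j) 8)) (nameAt A (neighbor (entry table j) 20))
      (nameAt A (neighbor (entry table j) 32)) (nameAt A (neighbor (entry table j) 44)) H V u k
      fail = true) :
    ∃ H' V', Interp T τ (A ||| u <<< (5 * j)) n P cols H' V' ν ∧ k H' V' = true := by
  have inj : ∀ u v, 1 ≤ u → u ≤ n → 1 ≤ v → v ≤ n → (ν u).west = (ν v).west →
      (ν u).south = (ν v).south → u = v := fun u v h₁ h₂ h₃ h₄ h₅ h₆ => by
    by_contra huv
    have := hT _ (h.naming.mem u h₁ h₂) _ (h.naming.mem v h₃ h₄)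
      fun e => huv (h.naming.inj u v h₁ h₂ h₃ h₄ e)
    tauto
  have W : ∀ u, u ≤ n → labH ν u = (ν u).west := fun u hu => by simp [labH, hu.trans_lt hn]
  have S : ∀ u, u ≤ n → labV ν u = (ν u).south := fun u hu => by simp [labV, hu.trans_lt hn]
  have E : ∀ u, labH ν (32 + u) = (ν u).east := fun u => by simp [labH]
  have N : ∀ u, labV ν (32 + u) = (ν u).north := fun u => by simp [labV]
  have injH : ∀ u v, 1 ≤ u → u ≤ n → 1 ≤ v → v ≤ n → labH ν u = labH ν v →
      labV ν u = labV ν v → u = v := fun u v h₁ h₂ h₃ h₄ => by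
    rw [W u h₂, W v h₄, S u h₂, S v h₄]; exact inj u v h₁ h₂ h₃ h₄
  have injV : ∀ u v, 1 ≤ u → u ≤ n → 1 ≤ v → v ≤ n → labV ν u = labV ν v →
      labH ν u = labH ν v → u = v := fun u v h₁ h₂ h₃ h₄ h₅ h₆ => injH u v h₁ h₂ h₃ h₄ h₆ h₅
  -- Index 0 stands for a missing neighbor and is never named, so a neighbor with a name is a real
  -- one.
  have nz : ∀ i, nameAt A i ≠ 0 → i ≠ 0 := fun i hi h0 => hi (h0 ▸ h.zero)
  obtain ⟨H₁, hH₁, ht⟩ := identify_sound injH h.classesH h.classesV hn (fun ha => by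
    obtain ⟨a₁, a₂⟩ := h.name _ ha
    refine ⟨⟨hu₁, hu⟩, ⟨by omega, a₁⟩, ?_⟩
    rw [W u hu, E, ← a₂, ← hju, hτ.west j hj (nz _ ha)]) ht
  obtain ⟨H₂, hH₂, ht⟩ := identify_sound injH hH₁ h.classesV hn (fun ha => by
    obtain ⟨a₁, a₂⟩ := h.name _ ha
    refine ⟨⟨by omega, a₁⟩, ⟨hu₁, hu⟩, ?_⟩
    rw [W _ a₁, E, ← a₂, ← hju, hτ.east j hj (nz _ ha)]) ht
  obtain ⟨V₁, hV₁, ht⟩ := identify_sound injV h.classesV hH₂ hn (fun ha => by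
    obtain ⟨a₁, a₂⟩ := h.name _ ha
    refine ⟨⟨hu₁, hu⟩, ⟨by omega, a₁⟩, ?_⟩
    rw [S u hu, N, ← a₂, ← hju, hτ.south j hj (nz _ ha)]) ht
  obtain ⟨V₂, hV₂, ht⟩ := identify_sound injV hV₁ hH₂ hn (fun ha => by
    obtain ⟨a₁, a₂⟩ := h.name _ ha
    refine ⟨⟨by omega, a₁⟩, ⟨hu₁, hu⟩, ?_⟩
    rw [S _ a₁, N, ← a₂, ← hju, hτ.north j hj (nz _ ha)]) ht
  refine ⟨H₂, V₂, ⟨h.naming, ?_, fun i hi => ?_, h.count, h.cols_eq, hH₂, hV₂⟩, ht⟩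
  · rw [nameAt_lor hA (hu.trans_lt hn), if_neg (Ne.symm hj₀), h.zero]
  · rw [nameAt_lor hA (hu.trans_lt hn)] at hi ⊢
    split_ifs at hi ⊢ with hij
    · exact ⟨hu, hij ▸ hju⟩
    · exact h.name i hi

/-- Strips the recursors and `force` off one step and discards the branches that return `false`. -/
theorem run_succ {table : ℕ} {bud : ℕ → Bool} {final : List ℕ → List ℕ → List ℕ → Bool}
    {fuel A n P : ℕ} {cols H V : List ℕ} {s : ℕ} {k : ℕ → Bool}
    (h : run table bud final (fuel + 1) A n P cols H V s k = true) :
    (s % 1024 = 0 ∧ final cols H V = true ∧ ∃ r, k r = true) ∨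
    ∃ j r, j < 1024 ∧ j ≠ 0 ∧ nameAt A j = 0 ∧ entry table j ≠ 0 ∧
      tryNames (entry table j % 16)
        (fun u r k => tryName (nameAt A (neighbor (entry table j) 8))
          (nameAt A (neighbor (entry table j) 20)) (nameAt A (neighbor (entry table j) 32))
          (nameAt A (neighbor (entry table j) 44)) H V u (fun H V =>
            run table bud final fuel (A ||| u <<< (5 * j)) n P cols H V r k) (k r))
        (fun r => Bool.rec (k r) (tryName (nameAt A (neighbor (entry table j) 8))
          (nameAt A (neighbor (entry table j) 20)) (nameAt A (neighbor (entry table j) 32))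
          (nameAt A (neighbor (entry table j) 44)) H V (n + 1) (fun H V =>
            run table bud final fuel (A ||| (n + 1) <<< (5 * j)) (n + 1)
              (P + 256 ^ (entry table j % 16))
              ((entry table j % 16 + 16 * (n + 1)) :: cols) H V r k) (k r))
          (bud (P + 256 ^ (entry table j % 16)))) cols r = true := by
  change step table bud final (run table bud final fuel) A n P cols H V s k = true at h
  generalize run table bud final fuel = ih at h ⊢
  simp only [step, force_eq] at h
  have hlt : s % 1024 < 1024 := Nat.mod_lt _ (by norm_num)
  cases hs : Nat.div s 1024 with
  | zero => simp [hs] at h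
  | succ r' =>
    simp only [hs] at h
    cases hj : Nat.mod s 1024 with
    | zero =>
      simp only [hj] at h
      cases hf : final cols H V with
      | false => simp [hf] at h
      | true => simp only [hf] at h; exact .inl ⟨hj, rfl, _, h⟩
    | succ j =>
      simp only [hj] at h
      change s % 1024 = j + 1 at hj
      cases hA : Nat.beq (nameAt A (j + 1)) 0 with
      | false => simp [hA] at h
      | true =>
        simp only [hA] at h
        have hA := Nat.eq_of_beq_eq_true hA
        cases he : entry table (j + 1) with
        | zero => simp [he] at h
        | succ e =>
          refine .inr ⟨j + 1, Nat.succ r', hj ▸ hlt, by simp, hA, by simp [he], ?_⟩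
          simp only [he] at h ⊢
          exact h

/-- If the case analysis succeeds, then every tiling admits a naming that has passed the final
test. -/
theorem run_sound {T : Finset (TileType L)} {table : ℕ} {τ : ℕ → TileType L}
    (hT : Directed T) (hcard : T.card ≤ 21) (hτ : Placed T table τ) {bud : ℕ → Bool}
    (hbud : ∀ n ν, Naming T n ν → bud (colorCount (fun u => (ν u).color) n) = true)
    {final : List ℕ → List ℕ → List ℕ → Bool} {fuel : ℕ} :
    ∀ {A n P : ℕ} {cols H V : List ℕ} {s : ℕ} {k : ℕ → Bool},
      run table bud final fuel A n P cols H V s k = true →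
      (∃ r, k r = true) ∧ ∀ ν, Interp T τ A n P cols H V ν →
        ∃ A n P cols H V ν, Interp T τ A n P cols H V ν ∧ final cols H V = true := by
  induction fuel with
  | zero => exact fun h => by simp [run] at h
  | succ fuel ih =>
    intro A n P cols H V s k h
    rcases run_succ h with ⟨-, hf, hk⟩ | ⟨j, r, hj, hj₀, hA, he, h⟩
    · exact ⟨hk, fun ν hν => ⟨_, _, _, _, _, _, _, hν, hf⟩⟩
    -- `hold` provides the case of each old name, `hr'` that of a new name.
    obtain ⟨⟨r', hr'⟩, hold⟩ := tryNames_sound (fun u r k h => by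
      rcases tryName_progress h with h | ⟨_, _, h⟩
      · exact ⟨_, h⟩
      · exact (ih h).1) h
    constructor
    · cases hb : bud (P + 256 ^ (entry table j % 16)) with
      | false => rw [hb] at hr'; exact ⟨_, hr'⟩
      | true =>
        rw [hb] at hr'
        rcases tryName_progress hr' with h | ⟨_, _, h⟩
        · exact ⟨_, h⟩
        · exact (ih h).1
    intro ν hν
    have hc := hτ.color j hj he
    by_cases hex : ∃ u, 1 ≤ u ∧ u ≤ n ∧ τ j = ν u
    · obtain ⟨u, hu₁, hu, hju⟩ := hex
      have h16 := hν.naming.color u hu₁ hu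
      obtain ⟨r, k, h⟩ := hold ((ν u).color + 16 * u)
        (hν.cols_eq ▸ mem_colorList (κ := fun u => (ν u).color) hu₁ hu) (by
          rw [← hc, hju]; omega)
      rw [show ((ν u).color + 16 * u) / 16 = u by omega] at h
      obtain ⟨H', V', hI, h⟩ := hν.place hT hτ
        (by have := hν.naming.le_card; omega) hj hj₀ hA hu₁ hu hju h
      exact (ih h).2 ν hI
    · push Not at hex
      have h16 : (τ j).color < 16 := hc ▸ Nat.mod_lt _ (by norm_num)
      have hν' := hν.extend (by have := hν.naming.le_card; omega) (hτ.mem j hj he) h16 hex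
      have hb := hbud _ _ hν'.naming
      rw [← hν'.count, hc] at hb
      rw [hb] at hr'
      rw [hc] at hν'
      obtain ⟨H', V', hI, h⟩ := hν'.place hT hτ
        (by have := hν'.naming.le_card; omega) hj hj₀ hA (by omega) le_rfl (by simp) hr'
      exact (ih h).2 _ hI

/-! ### Tilings of the gadget -/

/-- The color of `gadget` in column `x` and row `y`. -/
def gadgetColor (x y : ℕ) : ℕ := if h : x < 265 ∧ y < 240 then gadget ⟨x, h.1⟩ ⟨y, h.2⟩ else 0

/-- A tiling by `T` that shows the pattern `gadget`. -/
structure GadgetTiling (T : Finset (TileType L)) (τ : ℕ → ℕ → TileType L) : Prop where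
  mem : ∀ x < 265, ∀ y < 240, τ x y ∈ T
  color : ∀ x < 265, ∀ y < 240, (τ x y).color = gadgetColor x y
  hor : ∀ x y, x + 1 < 265 → y < 240 → (τ x y).east = (τ (x + 1) y).west
  ver : ∀ x y, x < 265 → y + 1 < 240 → (τ x y).north = (τ x (y + 1)).south

/-- Tiles are never altered once attached, so labels matched at the moment of attachment stay
matched. -/
theorem Producible.labels {T : Finset (TileType L)} {σ : Seed L} {A : Assembly L}
    (h : Producible T σ A) : ∀ x y t, A x y = some t → 1 ≤ x ∧ 1 ≤ y ∧ t ∈ T ∧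
      westInput σ A x y = some t.west ∧ southInput σ A x y = some t.south := by
  induction h with
  | seed => intro x y t h; simp at h
  | attach A x₀ y₀ t₀ _ hc ih =>
    obtain ⟨⟨hx, -⟩, ⟨hy, -⟩, hv, ht, hw, hs⟩ := hc
    set A' : Assembly L := Function.update A x₀ (Function.update (A x₀) y₀ (some t₀)) with hA'
    have self : A' x₀ y₀ = some t₀ := by simp [hA']
    have other : ∀ x y, ¬ (x = x₀ ∧ y = y₀) → A' x y = A x y := by
      intro x y h
      by_cases hx : x = x₀
      · subst hx
        have : y ≠ y₀ := fun hy => h ⟨rfl, hy⟩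
        simp [hA', this]
      · simp [hA', hx]
    have keep : ∀ x y t, A x y = some t → A' x y = some t := by
      intro x y t h
      rw [other x y (by rintro ⟨rfl, rfl⟩; simp [hv] at h), h]
    have keepW : ∀ x y l, westInput σ A x y = some l → westInput σ A' x y = some l := by
      intro x y l h
      unfold westInput at h ⊢
      split_ifs at h ⊢
      · exact h
      · obtain ⟨t, ht, rfl⟩ := Option.map_eq_some_iff.1 h
        rw [keep _ _ _ ht]; rfl
    have keepS : ∀ x y l, southInput σ A x y = some l → southInput σ A' x y = some l := by
      intro x y l h
      unfold southInput at h ⊢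
      split_ifs at h ⊢
      · exact h
      · obtain ⟨t, ht, rfl⟩ := Option.map_eq_some_iff.1 h
        rw [keep _ _ _ ht]; rfl
    intro x y t h
    change A' x y = some t at h
    by_cases hxy : x = x₀ ∧ y = y₀
    · obtain ⟨rfl, rfl⟩ := hxy
      obtain rfl : t₀ = t := by simpa [self] using h
      exact ⟨hx, hy, ht, keepW _ _ _ hw, keepS _ _ _ hs⟩
    · rw [other x y hxy] at h
      obtain ⟨h₁, h₂, h₃, h₄, h₅⟩ := ih x y t h
      exact ⟨h₁, h₂, h₃, keepW _ _ _ h₄, keepS _ _ _ h₅⟩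

theorem exists_gadgetTiling {T : Finset (TileType L)} {σ : Seed L}
    {P : Pattern σ.width σ.height} (hP : P.Includes gadget) (h : IsTerminalPattern T σ P) :
    ∃ τ, GadgetTiling T τ := by
  obtain ⟨a, b, ha, hb, hP⟩ := hP
  obtain ⟨A, hA, hcol⟩ := h
  -- Patterns count cells from 0, assemblies from 1 because row and column 0 belong to the seed;
  -- hence the shift by one.
  have key : ∀ x y, ∃ t, x < 265 → y < 240 →
      A (a + x + 1) (b + y + 1) = some t ∧ t.color = gadgetColor x y := by
    have key : ∀ x y, x < 265 → y < 240 → ∃ t,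
        A (a + x + 1) (b + y + 1) = some t ∧ t.color = gadgetColor x y := by
      intro x y hx hy
      have h := hcol ⟨a + x, by omega⟩ ⟨b + y, by omega⟩
      rw [hP _ _ ⟨x, hx⟩ ⟨y, hy⟩ rfl rfl] at h
      obtain ⟨t, ht, hc⟩ := Option.map_eq_some_iff.1 h
      exact ⟨t, ht, by rw [hc, gadgetColor, dif_pos ⟨hx, hy⟩]⟩
    -- A default tile for cells outside the gadget.
    obtain ⟨t₀, -⟩ := key 0 0 (by norm_num) (by norm_num)
    intro x y
    by_cases h : x < 265 ∧ y < 240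
    · obtain ⟨t, ht⟩ := key x y h.1 h.2
      exact ⟨t, fun _ _ => ht⟩
    · exact ⟨t₀, fun hx hy => absurd ⟨hx, hy⟩ h⟩
  choose τ hτ using key
  refine ⟨τ, fun x hx y hy => (hA.labels _ _ _ (hτ x y hx hy).1).2.2.1,
    fun x hx y hy => (hτ x y hx hy).2, fun x y hx hy => ?_, fun x y hx hy => ?_⟩
  · have h := (hA.labels _ _ _ (hτ (x + 1) y hx hy).1).2.2.2.1
    rw [westInput, if_neg (by omega), show a + (x + 1) + 1 - 1 = a + x + 1 by omega,
      (hτ x y (by omega) hy).1] at h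
    simpa using h
  · have h := (hA.labels _ _ _ (hτ x (y + 1) hx hy).1).2.2.2.2
    rw [southInput, if_neg (by omega), show b + (y + 1) + 1 - 1 = b + y + 1 by omega,
      (hτ x y hx (by omega)).1] at h
    simpa using h

/-! ### Evaluation of the colors of the gadget -/

/-- The number with the digits `l` in base `B`, the last digit being the least significant one. -/
def packDigits (B : ℕ) (l : List ℕ) : ℕ := l.foldl (fun a d => a * B + d) 0

theorem packDigits_digit {B : ℕ} (hB : 0 < B) {l : List ℕ} (hl : ∀ d ∈ l, d < B) :
    ∀ (i : ℕ) (hi : i < l.length), packDigits B l / B ^ (l.length - 1 - i) % B = l[i] := by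
  induction l using List.reverseRecOn with
  | nil => intro i hi; simp at hi
  | append_singleton l d ih =>
    intro i hi
    have hd : d < B := hl d (by simp)
    have hp : packDigits B (l ++ [d]) = packDigits B l * B + d := by simp [packDigits]
    rw [hp]
    simp only [List.length_append, List.length_singleton] at hi ⊢
    rcases Nat.lt_or_ge i l.length with h | h
    · rw [List.getElem_append_left h, ← ih (fun d hd => hl d (by simp [hd])) i h,
        show l.length + 1 - 1 - i = l.length - 1 - i + 1 by omega, pow_succ', ← Nat.div_div_eq_div_mul,
        mul_comm (packDigits B l), Nat.mul_add_div hB, Nat.div_eq_of_lt hd, add_zero]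
    · obtain rfl : i = l.length := by omega
      simp [Nat.mod_eq_of_lt hd]

theorem color_lt_of_assembleRow {w : Glue} {gs : List Glue} {ts : List (TileType Glue)}
    (h : assembleRow w gs = some ts) : ∀ t ∈ ts, t.color < 16 := by
  induction gs generalizing w ts with
  | nil => simp_all [assembleRow]
  | cons g gs ih =>
    simp only [assembleRow] at h
    split at h
    · cases h
    · rename_i t ht
      split at h
      · cases h
      · rename_i ts' h'
        cases h
        intro t' ht'
        rcases List.mem_cons.1 ht' with rfl | ht'
        · have : ∀ t ∈ tevalList, t.color < 16 := by decide
          exact this _ (List.mem_of_find?_eq_some ht)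
        · exact ih h' t' ht'

theorem color_lt_of_assembleRows {gs ws : List Glue} {rows : List (List (TileType Glue))}
    (h : assembleRows gs ws = some rows) : ∀ row ∈ rows, ∀ t ∈ row, t.color < 16 := by
  induction ws generalizing gs rows with
  | nil => simp_all [assembleRows]
  | cons w ws ih =>
    simp only [assembleRows] at h
    split at h
    · cases h
    · rename_i row hrow
      split at h
      · cases h
      · rename_i rows' h'
        cases h
        intro row' hr
        rcases List.mem_cons.1 hr with rfl | hr
        · exact color_lt_of_assembleRow hrow
        · exact ih h' row' hr

/-- Evaluate the packed colors of a row. -/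
def packRow {α : Type} (l : List (TileType Glue)) : ℕ → (ℕ → α) → α :=
  List.rec (motive := fun _ => ℕ → (ℕ → α) → α) (fun a k => k a)
    (fun t _ ih a k => force (Nat.add (Nat.mul a 16) t.color) fun a => ih a k) l

/-- Evaluate the packed colors of a list of rows of width `w`. -/
def packRows {α : Type} (w : ℕ) (l : List (List (TileType Glue))) : ℕ → (ℕ → α) → α :=
  List.rec (motive := fun _ => ℕ → (ℕ → α) → α) (fun a k => k a)
    (fun r _ ih a k => packRow r 0 fun d =>
      force (Nat.add (Nat.mul a (Nat.pow 16 w)) d) fun a => ih a k) l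

theorem packRow_eq {α : Type} (l : List (TileType Glue)) (a : ℕ) (k : ℕ → α) :
    packRow l a k = k ((l.map TileType.color).foldl (fun a d => a * 16 + d) a) := by
  induction l generalizing a with
  | nil => rfl
  | cons t l ih =>
    change force (a * 16 + t.color) (fun a => packRow l a k) = _
    rw [force_eq, ih]
    rfl

theorem packRows_eq {α : Type} (w : ℕ) (l : List (List (TileType Glue))) (a : ℕ) (k : ℕ → α) :
    packRows w l a k = k ((l.map fun r => packDigits 16 (r.map TileType.color)).foldl
      (fun a d => a * 16 ^ w + d) a) := by
  induction l generalizing a with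
  | nil => rfl
  | cons r l ih =>
    change packRow r 0 (fun d => force (a * 16 ^ w + d) (fun a => packRows w l a k)) = _
    rw [packRow_eq, force_eq, ih]
    rfl

theorem packDigits_lt {B : ℕ} {l : List ℕ} (hl : ∀ d ∈ l, d < B) :
    packDigits B l < B ^ l.length := by
  induction l using List.reverseRecOn with
  | nil => simp [packDigits]
  | append_singleton l d ih =>
    have hd : d < B := hl d (by simp)
    have hp : packDigits B (l ++ [d]) = packDigits B l * B + d := by simp [packDigits]
    have := ih fun d hd => hl d (by simp [hd])
    rw [hp, List.length_append, List.length_singleton, pow_succ]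
    nlinarith

/-- The color in column `x` and row `y` of a packed pattern of width `w` and height `h`. -/
def colorAt (w h G x y : ℕ) : ℕ :=
  Nat.mod (Nat.shiftRight G (Nat.mul 4 (Nat.add (Nat.mul w (Nat.sub (Nat.pred h) y))
    (Nat.sub (Nat.pred w) x)))) 16

/-- The cell of column 0 and row 0 is the most significant digit, so the shift in `colorAt` counts
cells from the opposite corner. -/
theorem colorAt_packRows {w : ℕ} {rows : List (List (TileType Glue))}
    (hw : ∀ r ∈ rows, r.length = w) (hcol : ∀ r ∈ rows, ∀ t ∈ r, t.color < 16) {x y : ℕ}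
    (hy : y < rows.length) (hx : x < rows[y].length) :
    colorAt w rows.length
      (packDigits (16 ^ w) (rows.map fun r => packDigits 16 (r.map TileType.color))) x y =
      rows[y][x].color := by
  have hlt : ∀ d ∈ rows.map fun r => packDigits 16 (r.map TileType.color), d < 16 ^ w := by
    intro d hd
    obtain ⟨r, hr, rfl⟩ := List.mem_map.1 hd
    rw [← hw r hr, ← List.length_map (f := TileType.color)]
    apply packDigits_lt
    intro c hc
    obtain ⟨t, ht, rfl⟩ := List.mem_map.1 hc
    exact hcol r hr t ht
  have hxw : rows[y].length = w := hw _ (List.getElem_mem hy)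
  have h₁ := packDigits_digit (by positivity) hlt y (by rw [List.length_map]; exact hy)
  have h₂ := packDigits_digit (B := 16) (by norm_num) (l := rows[y].map TileType.color)
    (fun c hc => by
      obtain ⟨t, ht, rfl⟩ := List.mem_map.1 hc
      exact hcol _ (List.getElem_mem hy) t ht) x (by rw [List.length_map]; exact hx)
  simp only [List.getElem_map, List.length_map] at h₁ h₂
  rw [← h₂, ← h₁, hxw]
  generalize packDigits (16 ^ w) (rows.map fun r => packDigits 16 (r.map TileType.color)) = N
  change N >>> (4 * (w * (rows.length - 1 - y) + (w - 1 - x))) % 16 = _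
  rw [Nat.shiftRight_eq_div_pow, pow_mul, show (2 : ℕ) ^ 4 = 16 by norm_num, pow_add, pow_mul,
    ← Nat.div_div_eq_div_mul]
  have : (16 : ℕ) ^ w = 16 ^ (w - 1 - x) * 16 ^ (x + 1) := by rw [← pow_add]; congr 1; omega
  generalize N / (16 ^ w) ^ (rows.length - 1 - y) = N
  rw [this, Nat.mod_mul_right_div_self, Nat.mod_mod_of_dvd _ (dvd_pow_self 16 (by omega))]

/-- With the test `p` as continuation of the packing, the packed pattern `G` is evaluated first and
every check inside `p` uses this literal. -/
theorem gadgetColor_of_packRows {p : ℕ → Bool} (h : packRows 265 gadgetRows 0 p = true) :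
    ∃ G, p G = true ∧ ∀ x < 265, ∀ y < 240, colorAt 265 240 G x y = gadgetColor x y := by
  rw [packRows_eq] at h
  refine ⟨_, h, fun x hx y hy => ?_⟩
  have hy' : y < gadgetRows.length := by rw [gadgetRows_length]; exact hy
  have hx' : x < gadgetRows[y].length := by rw [gadgetRows_getElem_length]; exact hx
  have h₄ : gadgetColor x y = (gadgetRows[y][x]).color := by
    rw [gadgetColor, dif_pos ⟨hx, hy⟩]; rfl
  rw [h₄, ← colorAt_packRows (fun r hr => ((length_of_assembleRows assembleRows_gadget).2 r
    hr).trans gadgetXAxis_length) (color_lt_of_assembleRows assembleRows_gadget) hy' hx',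
    gadgetRows_length, packDigits]

/-- The cells with `x ≤ column < x + w` and `y ≤ row < y + h` have the color `c`. -/
def HasRect (c x w y h : ℕ) : Prop := ∀ i < w, ∀ j < h, gadgetColor (x + i) (y + j) = c

/-- `f 0`, …, `f (n - 1)` are all true. -/
def allBelow (f : ℕ → Bool) (n : ℕ) : Bool :=
  Nat.rec true (fun i ih => Bool.rec false ih (f i)) n

theorem allBelow_iff {f : ℕ → Bool} {n : ℕ} (h : allBelow f n = true) : ∀ i < n, f i = true := by
  induction n with
  | zero => intro i hi; omega
  | succ n ih =>
    change Bool.rec false (allBelow f n) (f n) = true at h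
    intro i hi
    cases hf : f n with
    | false => simp [hf] at h
    | true =>
      rw [hf] at h
      rcases Nat.lt_or_ge i n with h' | h'
      · exact ih h i h'
      · obtain rfl : i = n := by omega
        exact hf

/-- Check that a rectangle is monochromatic of color `c`. -/
def rectOk (G c x w y h : ℕ) : Bool :=
  and (Nat.ble (x + w) 265) (and (Nat.ble (y + h) 240)
    (allBelow (fun i => allBelow (fun j => Nat.beq (colorAt 265 240 G (Nat.add x i) (Nat.add y j)) c) h) w))

theorem rectOk_sound {G : ℕ} (hG : ∀ x < 265, ∀ y < 240, colorAt 265 240 G x y = gadgetColor x y)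
    {c x w y h : ℕ} (hr : rectOk G c x w y h = true) : HasRect c x w y h := by
  simp only [rectOk, Bool.and_eq_true] at hr
  obtain ⟨h₁, h₂, h₃⟩ := hr
  have h₁ := Nat.le_of_ble_eq_true h₁
  have h₂ := Nat.le_of_ble_eq_true h₂
  intro i hi j hj
  rw [← hG _ (by omega) _ (by omega)]
  exact Nat.eq_of_beq_eq_true (allBelow_iff (allBelow_iff h₃ i hi) j hj)

/-- Position `j` of `table` has the given color and neighbors. -/
def entryOk (table G j : ℕ) : Bool :=
  force (entry table j) fun e =>
  Nat.rec true (fun _ _ =>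
    force (neighbor e 56) fun x =>
    force (neighbor e 72) fun y =>
    and (Nat.blt x 265) <| and (Nat.blt y 240) <| and (Nat.beq (colorAt 265 240 G x y) (Nat.mod e 16)) <|
    and (force (neighbor e 8) fun i => Nat.rec true (fun _ _ =>
      and (Nat.beq (Nat.succ (neighbor (entry table i) 56)) x)
        (Nat.beq (neighbor (entry table i) 72) y)) i) <|
    and (force (neighbor e 20) fun i => Nat.rec true (fun _ _ =>
      and (Nat.beq (neighbor (entry table i) 56) x)
        (Nat.beq (Nat.succ (neighbor (entry table i) 72)) y)) i) <|
    and (force (neighbor e 32) fun i => Nat.rec true (fun _ _ =>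
      and (Nat.blt (Nat.succ x) 265) <| and (Nat.beq (neighbor (entry table i) 56) (Nat.succ x))
        (Nat.beq (neighbor (entry table i) 72) y)) i)
    (force (neighbor e 44) fun i => Nat.rec true (fun _ _ =>
      and (Nat.blt (Nat.succ y) 240) <| and (Nat.beq (neighbor (entry table i) 56) x)
        (Nat.beq (neighbor (entry table i) 72) (Nat.succ y))) i)) e

theorem neighbor_zero (i : ℕ) : neighbor 0 i = 0 := by
  change (0 >>> i) % 1024 = 0
  simp

/-- Each entry records its own column and row, so adjacency is checked by comparing the coordinates
recorded for the two positions. -/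
theorem placed_of_entryOk {T : Finset (TileType L)} {τ : ℕ → ℕ → TileType L}
    (hτ : GadgetTiling T τ) {G table : ℕ}
    (hG : ∀ x < 265, ∀ y < 240, colorAt 265 240 G x y = gadgetColor x y)
    (h : allBelow (entryOk table G) 1024 = true) :
    Placed T table fun j => τ (neighbor (entry table j) 56) (neighbor (entry table j) 72) := by
  have key : ∀ j < 1024, entry table j ≠ 0 → ∃ x y, neighbor (entry table j) 56 = x ∧
      neighbor (entry table j) 72 = y ∧ x < 265 ∧ y < 240 ∧ gadgetColor x y = entry table j % 16 ∧
      (neighbor (entry table j) 8 ≠ 0 →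
        neighbor (entry table (neighbor (entry table j) 8)) 56 + 1 = x ∧
        neighbor (entry table (neighbor (entry table j) 8)) 72 = y) ∧
      (neighbor (entry table j) 20 ≠ 0 →
        neighbor (entry table (neighbor (entry table j) 20)) 56 = x ∧
        neighbor (entry table (neighbor (entry table j) 20)) 72 + 1 = y) ∧
      (neighbor (entry table j) 32 ≠ 0 → x + 1 < 265 ∧
        neighbor (entry table (neighbor (entry table j) 32)) 56 = x + 1 ∧
        neighbor (entry table (neighbor (entry table j) 32)) 72 = y) ∧
      (neighbor (entry table j) 44 ≠ 0 → y + 1 < 240 ∧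
        neighbor (entry table (neighbor (entry table j) 44)) 56 = x ∧
        neighbor (entry table (neighbor (entry table j) 44)) 72 = y + 1) := by
    intro j hj he
    have h := allBelow_iff h j hj
    refine ⟨_, _, rfl, rfl, ?_⟩
    simp only [entryOk, force_eq] at h
    cases he' : entry table j with
    | zero => exact absurd he' he
    | succ e =>
      simp only [he', Bool.and_eq_true] at h
      obtain ⟨h₁, h₂, h₃, h₄, h₅, h₆, h₇⟩ := h
      have h₁ := Nat.le_of_ble_eq_true h₁
      have h₂ := Nat.le_of_ble_eq_true h₂
      have h₃ := Nat.eq_of_beq_eq_true h₃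
      refine ⟨h₁, h₂, by rw [← hG _ h₁ _ h₂]; exact h₃, fun h => ?_, fun h => ?_, fun h => ?_,
        fun h => ?_⟩
      · obtain ⟨i, hi⟩ := Nat.exists_eq_succ_of_ne_zero h
        rw [hi] at h₄ ⊢
        simp only [Bool.and_eq_true] at h₄
        exact ⟨Nat.eq_of_beq_eq_true h₄.1, Nat.eq_of_beq_eq_true h₄.2⟩
      · obtain ⟨i, hi⟩ := Nat.exists_eq_succ_of_ne_zero h
        rw [hi] at h₅ ⊢
        simp only [Bool.and_eq_true] at h₅
        exact ⟨Nat.eq_of_beq_eq_true h₅.1, Nat.eq_of_beq_eq_true h₅.2⟩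
      · obtain ⟨i, hi⟩ := Nat.exists_eq_succ_of_ne_zero h
        rw [hi] at h₆ ⊢
        simp only [Bool.and_eq_true] at h₆
        exact ⟨Nat.le_of_ble_eq_true h₆.1, Nat.eq_of_beq_eq_true h₆.2.1,
          Nat.eq_of_beq_eq_true h₆.2.2⟩
      · obtain ⟨i, hi⟩ := Nat.exists_eq_succ_of_ne_zero h
        rw [hi] at h₇ ⊢
        simp only [Bool.and_eq_true] at h₇
        exact ⟨Nat.le_of_ble_eq_true h₇.1, Nat.eq_of_beq_eq_true h₇.2.1,
          Nat.eq_of_beq_eq_true h₇.2.2⟩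
  have nz : ∀ j i, neighbor (entry table j) i ≠ 0 → entry table j ≠ 0 := fun j i h h0 =>
    h (by rw [h0, neighbor_zero])
  refine ⟨fun j hj he => ?_, fun j hj he => ?_, fun j hj he => ?_, fun j hj he => ?_,
    fun j hj he => ?_, fun j hj he => ?_⟩
  · obtain ⟨x, y, rfl, rfl, hx, hy, -⟩ := key j hj he
    exact hτ.mem _ hx _ hy
  · obtain ⟨x, y, rfl, rfl, hx, hy, hc, -⟩ := key j hj he
    exact (hτ.color _ hx _ hy).trans hc
  · obtain ⟨x, y, h₁, h₂, hx, hy, -, hw, -⟩ := key j hj (nz _ _ he)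
    obtain ⟨rfl, h'⟩ := hw he
    simp only [h₁, h₂, h']
    exact hτ.hor _ _ hx hy
  · obtain ⟨x, y, h₁, h₂, hx, hy, -, -, hs, -⟩ := key j hj (nz _ _ he)
    obtain ⟨h', rfl⟩ := hs he
    simp only [h₁, h₂, h']
    exact hτ.ver _ _ hx hy
  · obtain ⟨x, y, h₁, h₂, hx, hy, -, -, -, hs, -⟩ := key j hj (nz _ _ he)
    obtain ⟨h₀, h', h''⟩ := hs he
    simp only [h₁, h₂, h', h'']
    exact hτ.hor _ _ h₀ hy
  · obtain ⟨x, y, h₁, h₂, hx, hy, -, -, -, -, hs⟩ := key j hj (nz _ _ he)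
    obtain ⟨h₀, h', h''⟩ := hs he
    simp only [h₁, h₂, h', h'']
    exact hτ.ver _ _ hx h₀

/-! ### Case analyses for parts of the gadget -/

/-- The maximum of `a` and `b`. -/
def natMax (a b : ℕ) : ℕ := Nat.add a (Nat.sub b a)

/-- At most three tiles are `CE` or yellow. -/
def stairsBudget (P : ℕ) : Bool := Nat.ble (Nat.add (digit P 1) (digit P 8)) 3

/-- There is just one tile of color `d`, at least three tiles have color `w`, and there is one
tile to spare among the tiles of a white or black diagonal. -/
def diagonalBudget (w d P : ℕ) : Bool :=
  and (Nat.ble (digit P d) 1) (Nat.ble (Nat.add (natMax (digit P w) 3)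
    (Nat.add (natMax (digit P d) 1) (Nat.add (natMax (digit P 6) 2)
    (Nat.add (natMax (digit P 9) 1) (natMax (digit P 10) 1))))) 9)

/-- There are at least `c` tiles of color cyan, and 21 tiles altogether. -/
def fullBudget (c P : ℕ) : Bool :=
  Nat.ble (Nat.add (natMax (digit P 0) c) (Nat.add (natMax (Nat.add (digit P 1) (digit P 8)) 4)
    (Nat.add (natMax (digit P 2) 2) (Nat.add (natMax (digit P 3) 2) (Nat.add (natMax (digit P 4) 2)
    (Nat.add (natMax (digit P 5) 2) (Nat.add (natMax (digit P 6) 2) (Nat.add (natMax (digit P 7) 1)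
    (Nat.add (natMax (digit P 9) 1) (natMax (digit P 10) 1)))))))))) 21

/-- There are three tiles of color cyan, and 21 tiles altogether. -/
def cornerBudget (P : ℕ) : Bool := and (Nat.ble (digit P 0) 3) (fullBudget 3 P)

/-- Cells in the rows of the yellow stairs. The tables below take cells near the lowest white and
black diagonals, near the northeast corner of `LB4`, and from all these regions together for the
last search. -/
def stairsTable : ℕ :=
  0x3c00310000000140130800003b00310150000000120800003c00300000150120000100003b003001301400000001000039002800000000000c0100003e002700000000f00b0100003d002701000000e00a0800003c002700f00000d0000800003b002700e0000000000800003900270000110000000800003e002600001000a0000100003d002600b00f0000000100003e00200000000000080100003e001f0000090000000100003b000a0000000060000100003a000a00700000000408000038000a0000000000020800003a00090000060030010100003900090040000020000800003800090030050000000800003a000800000400000001000000000000000000000000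

/-- A script only chooses the order in which cells are named in each case. A bad script makes `run`
return `false`; soundness does not depend on how it was found. -/
def stairsScript : ℕ :=
  0x10280b04c12004100440503c0c00806050030080601c1404c08020060500a02c100140f04808030020500d0380f04014020120140c020020441300c0405409

def whiteDiagonalTable : ℕ :=
  0x47004a00000002101c09000046004a02200002001b0a000045004a02100001f01a09000044004a02000001e01909000043004a01f0000000180900003f004a00000000001709000047004900002201b00006000046004901c02101a00006000045004901b02001900006000044004901a01f01800006000043004901901e0000000600003f004900001d00000006000047004400000001500f09000046004401600000000e0a000044004400000001300009000043004401400001200d09000042004401300001100c0a000041004401200001000b0a000040004401100000000a09000047004300001600e00906000046004300f01500000006000043004300001300c00006000042004300d01200b00006000041004300c01100a00006000040004300b01000000006000047004200000f00000004000044003f00000000000004000042003e0000000060040a000041003e0070000050030a000040003e00600000000209000042003d00000700300106000041003d00400600200006000040003d00300500000006000042003c00000400000004000000000000000000000000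

def whiteDiagonalScript : ℕ :=
  0x42108007010190281803c0b0402207c1e0501d0580f0540d014070101403c0c0340e010150301d01c2106c1a080040640a0401c0881f0601e01c0e0101501c04008050281000c0401c0d0300f018160100f0581501c0c0740d02c11024010201205c13

def blackDiagonalTable : ℕ :=
  0xaa00b7000000000000050000a800b5000000014000090000a700b501500001300c0a0000a600b501400001200b090000a500b501300001100a0a0000a400b50120000100090a0000a300b501100000f000090000a200b501000000e008090000a100b500f0000000070900009700b5000000000000090000a700b400001400b006060000a600b400c01300a000060000a500b400b012009000060000a400b400a011000000060000a200b400000f007000060000a100b400800e000000060000a700b300000c000000050000a100ae000000004003090000a000ae0050000000020a0000a100ad000005002001060000a000ad003004000000060000a100ac00000300000005000000000000000000000000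

def blackDiagonalScript : ℕ :=
  0x40a050090500b054100380f04c0a02c0e03c1301403024040280b00c04020070380303c020100a020070380f028030240502c1305011018010580c0480d

def cornerTable : ℕ :=
  0x3600390000000000bc0200003400390000000000ba0200003600380000be0bb0b20200003500380bc0000ba0b10200003400380bb0bd0b90b00200003300380ba0000000af0200003c00370000000b70ae0900003b00370b80000b60ad0900003a00370b70000b50ac0900003900370b60000b40ab0900003800370b50000b30aa0900003700370b40000b20a90900003600370b30bc0b10a80900003500370b20bb0b00a70a00003400370b10ba0af0a60a00003300370b00b90000a50900003c00360000b80ad0a40600003b00360ae0b70ac0000600003a00360ad0b60ab0a30600003900360ac0b50aa0a20600003800360ab0b40a90a10600003700360aa0b30a80a00600003600360a90b20a709f0600003500360a80b10a609e0600003400360a70b00a509d0600003300360a60af00009c0600003c00350000ae00009b0100003a00350000ac0a20990200003900350a30ab0a10980200003800350a20aa0a00970200003700350a10a909f0960200003600350a00a809e09502000035003509f0a709d09402000034003509e0a609c09302000033003509d0a50000920200003c00340000a409a0910900003b003409b0000990900600003a003409a0a309808f0900003900340990a209708e0900003800340980a109608d0900003700340970a009508c09000036003409609f09408b0900003500340950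9e09308a0a000034003409409d0920890a000033003409309c0000880900003c003300009b0900870700003b003309109a08f0860900003a003309009908e08506000039003308f09808d08406000038003308e09708c08306000037003308d09608b08206000036003308c09508a08106000035003308b09408908006000034003308a09308807f06000033003308909200007e0600003c003200009108607b0100003b003208709008507a0700003a003208608f08407909000039003208508e08307809000038003208408d08207709000037003208308c08107609000036003208208b08007509000035003208108a07f0740a000034003208008907e0730a000033003207f08807d07209000032003207e00007c07109000031003207d0000000700900003c003100008707a06f0800003b003107b08607906e0800003a003107a08507806d00000039003107908407706c00000038003107808307606b00000037003107708207506a00000036003107608107406900000035003107508007306800000034003107407f07206700000033003107307e07106600000032003107207d07006500000031003107107c0000640000003c003000007b06e0630100003b003006f07a06d0620100003a003006e07906c06107000039003006d07806b00006000038003006c07706a06006000037003006b07606905f06000036003006a07506805e06000035003006907406705d06000034003006807306605c06000033003006707206505b06000032003006607106405a0600003100300650700000590600003c002f00006f0620580100003b002f06306e0610570100003a002f06206d00005601000038002f00006b05f05402000037002f06006a05e05302000036002f05f06905d05202000035002f05e06805c05102000034002f05d06705b05002000033002f05c06605a04f02000032002f05b06505904e02000031002f05a06400004d0200003c002e0000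6305704c0100003b002e05806205604b0100003a002e05706105504a01000039002e05600005404907000038002e05506005304809000037002e05405f05204709000036002e05305e05104609000035002e05205d0500450a000034002e05105c04f0440a000033002e05005b04e04309000032002e04f05a04d00009000031002e04e0590000420900003c002d00005804b0410100003b002d04c05704a0400100003a002d04b05604903f01000039002d04a05504803e01000038002d04905404703d07000037002d04805304600006000036002d04705204500006000035002d04605104400006000034002d04505004300006000033002d04404f00000006000031002d00004d0000000600003c002c00004c04003c0100003b002c04104b03f03b0100003a002c04004a03e03a01000039002c03f04903d03901000038002c03e0480000380100003c002b00004103b0370100003b002b03c04003a0360100003a002b03b03f03903501000039002b03a03e03803401000038002b03903d0000330100003c002a00003c03602c0100003b002a03703b03502b0100003a002a03603a03402a01000039002a03503903302901000038002a03403803200001000037002a03300003102800000036002a03200003002707000035002a03100002f0260a000034002a03000002e0250a000033002a02f00002d02409000032002a02e0000000000900003c002900003702b0230100003b002902c03602a0220100003a002902b03502902101000039002902a03400002001000037002900003202701f00000036002902803102601e01000035002902703002501d00000034002902602f02401c00000033002902502e00001b0000003c002800002c02201a0100003b002802302b0210190100003a002802202a02001801000039002802102900001701000037002800002801e0150000003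6002801f02701d01401000035002801e02601c01300000034002801d02501b01200000033002801c0240000110000003c00270000230190000800003b002701a0220180000800003a002701902101700008000039002701802001600008000038002701700001500008000037002701601f01401000000036002701501e01300f08000035002701401d01200e00000034002701301c01100d00000033002701201b00000c00000037002600001500f00b00000036002601001400e00a01000035002600f01300d00900000034002600e01200c00800000033002600d01100000700000037002500001000a00600000036002500b00f00900501000035002500a00e00800400000034002500900d00700300000033002500800c00000200000037002400000b00500000000036002400600a00400001000035002400500900300100000034002400400800200000000033002400300700000000000035002300000400000000000000000000000000000000

def cornerScript : ℕ :=
  0x11e0771d8791d47004c1d098731cc751cc6c1cc6e1580f038130746109827078482186d1203d0f80f0380d030100441f0541204c1d098730701b090240741206c240843d0fc220f86e12856184130a0320cc3804c0e03c3d120560882b0d83b1004b15c621b81d1846d070261cc2507827184561283f0e8350a821080290d0390cc380f43e1201e09c31184561283f0e8350a821080290d0390cc380f43e1201e09c6d1b81e0c82807c15098250901d094240986e1885712c400ec360ac22184561283f0e8350a821080290d0390cc3e078730e03d07425090261b86215c4b1003b0d82b0881e120270c4861e4781d4771d87205c641646a17c681746616c6717065168191a45e1ac60058180507a290ae2e0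a02a4b3140a62c0511245413852134532744f2388422c972242f1fc2e1d0301f88a2648026c8524c7d254b01445d1c0721cc4012c3f1283d0843b0d82b088190f8181e8721d8731c8781fc730842206418128611e86e0c8721cc6e0c8721c8240947209432090720c026098720746e1885712c400ec360ac19088731fc330e03d0786109c15058140a0320cc380f4280c8330e03d0c0260746e1885712c400ec360ac220641e0581504c14060271fc73074130481c098250942f090730bc1c094241b8240946e06c240706e090250bc6e1b832188611b8320a01f0541002c621846e0c82807c150400b188611b8320a01f0541002c06070240941c0941c09426074130c81e07414188611b82709830188611b832188611b832188611b8320a0120702506c240bc4a1cc7f1c87a0e8350a8210fc181287a184561e4771247519c5c110501a07f1d0bd190592e89c1a85f1985b1685e280b0274a61c8761a0751cc741fc9d270a0180771acb02987f2749c2805e1a4b02987f2749c2805a194aa294a922ca4238892b88a224a4238ae22893260b42ccb82bc83150921344e14c522084813c8425c810b86d1f8312149926c7d21895070241c8701c8740481b090721c8761d00d0441b090720200c0441b090720507a0507a03c5618414158610507a09c490507a0f4480507a09c310507a1846d1e47803813074261d06d074740986e1885712c400ec190882b0d827078610f448060210a8350e83f1285609c1e050490f84909c1e09c6d1b8270785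61846d1b81e09c310c82807c1507426074130380909c0f0c40f09c1e03813074261d0160507a1e4781c8721e06c034121dc1c1d473190591a85f1985b1945a1a05d1a45e19c5c290ae2e06b180a62c0a82c8501444d150531385227c8e2104f2749722c7f0b8891f8250bc8a2147d2649b24c302541d09873070241c81d0981206c721d01d04c79074261c81c090731d46616c651686817469178671701e0507a290ae2e050298b02a0b21444e1489f13c9d2388409c9722c7f0b8892047e0942f228851f49926c930c0951c0721d0730507a1846c1e47804c1d1dc76098741cc5603c0e0340c0441204c1d098730701b0781409c7a1846c1e0241e4241580f0381307426074400ec360ac4b15857188220843d120561886f1b8261e473080290d0170e4190603e050271247a184731e06c1d0771d8721d4641646616c6a17c65168681746917867170a42b8b81ac60140a62c0a82c8512384e20c4d14c9f1485413c84274971fc8222c2e0942f224811f88a2147d2649b24c950c09e280b01003b12c3f1283d084360ac18088190f87a1d4730987f140671c0721cc721d8731d87803c6e078141e81403c621286e158611e80f0501e09c0e04c1d094730986e1586109c0f1b81e05062128561846e09c7a038130741c09076098730942f1e4250701d1c876098731fc6817445144771fc731dc761e06c1d4441406717049298641646616c6a17c65168691786b1809d1d08b290a82a4892b88a224a42a0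a92b88a24c9f2bcb32e0832c84e1344f210531485425c821f82e24848204851f49926c952288a0702419c721d8751003b12c3f1283d084360ac180f8220647a1c0720481b090721d8750341106c241c8761d4080301106c241c8761d40301c0c0441b090721d075098320cc380f4561842703c27050791e00e04c1d1dc261d07503c27050791e01303877098741d4761e8700841808819128611e86e1e4781dc76098741b8740746e098791e0771d8751842703c6e078141884a1846e09c0e074261d0751d8771e00f09c1404c0e098741b8270280f0500903874074130740f03813074321b81e05062128611b827098751e47a0e8350a8210603f1287a184561c8082285d1c0721d0721d8741d8780841808819128611e81d1d07603c0e05013074761d026064220ac360ec4012c571886e0786109c0f0382705013074261d01e03c1403c6e07814188611b8271280e074260746e09c1e03c0e04c1e074321b862128611b827050261d0721d87a0e8350a8210603f1287a184561e4771d48a174681dc721e06c034120708a1445c19c491cc641646616c6a17c65168691789d1fc8a1fc9d270a01806b0942f2207c2a8a5290a82a4ae224922bcb42ccb81344e210b213c53148851508225c7e0b87d120992049b2546e1586109c1e1582703c141b81e0506e078140780f05032078141886e09c4a158491847a03813074671cc68070671cc7f06ca42b8b80906a1a479214261d875094821d02e1f44822c8a2648126c9504c1d098261d0241c8761e47504c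1d098261d0261d8761d4261d0761d41307479094771b86215c4b1003b0e8360d42b0a83f0882108029060340e46616c1905c3e1281e124141586109c7a0f46a17c68174651686917883290ae2e04e2144f19c5c238841aca82c84714c5014882180510b87e27c5427497298b01cc7d2248b228992047f26c951a0671e48509472098751cc7e1d07d2048b2546c2349a26047204132141d0380f04c140986f18c581301a08c2c0dc3c1046e1885712c400ec36064220ac5618427204810c81e0506215c4b1003b0d82b088192042506c242140e03c0e04c8504c140902e0941c2041b0702403c14038130902e0946e09c0e04c1d04c1d0987a1e0841e06c20c771ac601d8741d47911c5311c5317c6a1c8761d07720c6b1804e16875194461485e1a48d25c471506c290472e0ae2f8bc2c8a82c8a82049f11c9b1a05d19c5c270a014c54148b42a89d11cb32a49911c98238531507e1f47314c52150af294b114051224a62c08b260972588b14ca62bca42b8b8238842248b204a82c44614429080340e4170f87a070241c8761dc1206c241c8761dc0d0441b090721d8770200c0441b090721d8771c0721d0721d8741d8781b8261d80f0381404c1d0981d0986e1885712c400ec360ac19088721d01e1586109c0f0382705013074261d01d1d0261b86212827078141841d03c0e04c1d1b81e05062128611b82703c0e1b81e050271d01d09862128611b862128611b832074740986e1885712c4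00ec360ac220642707814184561c87a1e4771d40d0481c0944920c6c1a0892f4641645d1945a19c6616c6a17c691786b180ba1709c2809d294af2a8b41384d290a92cc4f2b8b814053208511f82e1f4a825c8b26c8129c88248a42b8b8238a7210a822c81268a42b8b82dcb62d4b42cca92809f27497258a822c8111c8c11445140a42b8b82388422c812344413ca42b8b82388422c8120c8c23885208842a4662305b13cba2a0a719c852ec5c280bc27c9d204701c8741c8761d0761e0740a4200d03905c3e1e82e090251c8261d80f0381404c1d0987203c0e05013074261c82e09025074261d87e1d06e1885712c400ec36064220ac1e1586109c0f0382705013074261d07603c0e09c1404c1d098740b8240941b0b824094260b8240941d0986e1884a09c1e184140780f03813074260901e03c0e04c1d0981e03c0e04c1d0981b0902e0500f1b81e050621846e09c0e04c1d0982406c241b82703c6e0780e04c1d03c6e0780e04c1d06c24188611b827050260b84a0b8240941d0986e1885712c400ec360ac220642707814184561d0721d8821e8491e4771d46616c4313c64164421344e168652f8681746a17c69178bc1ac6019c5c2789f2809f274a42b8ae2e0a929ca8278a42b8b8238842a8a827c5b2784f290ae2e0ba2ec5c2808e2109c16c9213ca42b8b8238842805f1785d278a42b8b823884278a42b8b82e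c8e210751d07219466238841f87d2381b0701d09825090721d8751d0681a46a1ac6c178822a07e2102e1f4b92bc5b13ca42b8b82f8a0174a42b8b82ec29080340e4170f87a070241c8761d41206c241c8761d4701c8741c8761d0761e00d0441b090721d8080301106c241c87603c0e05013074261d06e1d01d1b8261c8561842703c0e09c1404c1d0987403c6e078141883d0f8611b82703874074130740904c1d0380f1b81e050620f43e1846e09c261c8761e80d048791dc771d8741e06c1d41c09449190591945a1985b1a05d1a85f1384d13c821aca42b8b82ec7e0b8841a47d1a0691a0ad1c0721d01c090721d8721d8741d8780481b090721d80d0441b090721d829080340e4170f87a0200c0441b090721d80301c0c0441b090721d80f0381404c1d098741b8740746e098721d8561842703c0e09c1404c1d098741b8270280f05009038260741e04c1d0240e03c6e050620f4610f86e09c261d0721d87a0200d12412070791dc251d4641646616c681749e1945a2084d13c4e2b8b81f82e1f4842b87d1f8721d07c1c07e1c87d1c8701f07e1f41d1f07e1f47c1f87d04c0e1f07e1f47c1f87d1f07e1f4701c8651687c1387e1c0721945a1f04e1f8701c8651687c1387e1b81e09c6e07827194701945a1f04e1883d1843e078140786e09c721f8490280f0140a03c141e8ae2b4040240e04c1d0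481c098251e4741d8721d8741d8781d02d0b8240946e03c6e0780f1b81e050ae0501e1b8ae078ae1b8140786e078190882b0d83b1004b15c3d0f849078140786e184ae1881e2b82709c6e03c05028050280f0500a03c050280f050ae1e80400c020240801c0e0340c04c120441d0701b0b42e09025098721d82406c240b81c0947603c1e09cae03c272b80f2b80a03c0a03cae09cae09c1e0500903813074260742d0901d0946e0981e1586109cae070240481b0901d04c0d0441b090080301106c24038091886e184140786e18456078271b80f1b81e03c6e078141b814188610f43e1246e078272b80e04c0d0481d0981c0942e1d80a03c0a03cae0240e0501307426070240481b0901d0341106c2404c0e0200c0441b0900909c6e03c0f188271b8050280f1843d0f849188050280f1843d0f8491886e078140380d04c1d04826070250b829080340e4170f81c0901206c240740d0441b09013038080301106c2400c070301106c240240f0100a0240f0500e0200d04c1d04826070250b86e09c250740e03c250c86e078621843d0f86e09c140b4260b42d0901c0901206c240341106c240200c0441b0901d04c0301c0c0441b0900e024040280f09c0100c0201c0c0441b090040140a03c140240e04c080742603412070250b8492b8761e8821d0791dc752e068174bb2dc691ac6a2b4b71e8ae290b62d4ac2aca32885f2805e2a8a92a0ba2389819cbc1805c27cb429c9d2048b2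cc8d140971449614c9b224b1298522c8b0150991344e168a92ccb22c46519c5c2809d25c96298b0204502248b1f87d1cc951fc9921085210852048922c9514c521509526451228480bc930c06d0c48620055284712507b2448723c90

def tightTable : ℕ :=
  0xaa00bc0000000001270a0000aa00bb000128000126060000aa00ba000127000125030000aa00b9000126000124030000aa00b8000125000123030000aa00b7000124000122050000aa00b6000123121120000000a900b612200000011f050000aa00b500012211f000000000a900b512012100011b070000a500b500000011d1190a0000a400b511e0000001180a0000a200b5000000000117090000a900b400011f11a116010000a800b411b000000000070000a500b400011e118115060000a400b411911d000114060000a200b400011c000113060000a900b300011b000112080000a500b3000119114111030000a400b3115118000110030000a200b300011700010f030000a900b2000116000000010000a500b200011511010e030000a400b211111400010d030000a200b200011300010c030000a500b100011110d10b050000a400b110e11000010a030000a200b100010f000109030000a500b000010e10a000000000a400b010b10d000000050000a200b000010c000108030000a200af0001090001050300009800af0000000000ff030000a300ae0000001050fe070000a200ae1061081040fd090000a100ae1050001030fc090000a000ae1040001020fb0a00009f00ae1030000000fa0a00009d00ae0000001000f90900009c00ae1010000000f80900009800ae0001070000000a0000a300ad0001060fd0f7010000a200ad0fe1050fc0f6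070000a100ad0fd1040fb0f5060000a000ad0fc1030fa0f40600009f00ad0fb1020000f30600009d00ad0001010f80f20600009c00ad0f91000000f1060000a300ac0000fe0f60f0010000a200ac0f70fd0f50ef010000a100ac0f60fc0f40ee050000a000ac0f50fb0f30ed0300009f00ac0f40fa0000ec0300009d00ac0000f90f10eb0300009c00ac0f20f80000ea030000a300ab0000f70ef0e9080000a200ab0f00f60ee0e8080000a100ab0ef0f50ed000000000a000ab0ee0f40ec0000500009f00ab0ed0f30000000300009d00ab0000f20ea0e70300009c00ab0eb0f10000e6030000a300aa0000f00e8000080000a200aa0e90ef0000000800009d00aa0000eb0e60e50300009c00aa0e70ea0000e40300009d00a90000e70e40e30300009c00a90e50e60000e20300009d00a80000e50e20e10500009c00a80e30e40000e00300009d00a70000e30e00000700009c00a70e10e20df0da0900009b00a70e00000de0d90a00009a00a70df0000dd0d80a00009900a70de0000dc0d70a00009800a70dd0000db0d60a00009700a70dc0000000d50900009c00a60000e00d90d40700009b00a60da0df0d80d30600009a00a60d90de0d70d20600009900a60d80dd0d60d10600009800a60d70dc0d50d00600009700a60d60db0000cf0600009c00a50000da0d30cd0800009b00a50d40d90d20c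c0500009a00a50d30d80d10cb0300009900a50d20d70d00ca0300009800a50d10d60cf0c90300009700a50d00d50000c80300009d00a40000000cd0c70800009c00a40ce0d40cc0c60800009b00a40cd0d30cb0c50000009a00a40cc0d20ca0c40500009900a40cb0d10c90c30300009800a40ca0d00c80c20300009700a40c90cf0000c10300009d00a30000ce0c60c00100009c00a30c70cd0c50bf0800009b00a30c60cc0c40be0000009a00a30c50cb0c30bd0000009900a30c40ca0c20bc0500009800a30c30c90c10bb0300009700a30c20c80000ba0300009d00a20000c70bf0000100009c00a20c00c60be0b90100009b00a20bf0c50bd0b80000009a00a20be0c40bc0b70000009900a20bd0c30bb0b60000009800a20bc0c20ba0b50500009700a20bb0c10000b40300009c00a10000bf0b80000100009b00a10b90be0b70000000009a00a10b80bd0b60000000009900a10b70bc0b50000000009800a10b60bb0b40000000009700a10b50ba0000000500004700440000000b20b00900004600440b30000000af0a00004800430000000b00ae0700004700430b10b30af0ad0600004600430b00b20000ac0600004800420000b10ad0000100004700420ae0b00ac0ab0400004600420ad0af0000aa0200004700410000ad0aa0000000004600410ab0ac00000004000042003e0000000a80a50a000041003e0a90000a70a40a000040003e0a80000000a3090000430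03d0000000a50a207000042003d0a60a90a40a106000041003d0a50a80a30a006000040003d0a40a700009f06000043003c0000a60a109e01000042003c0a20a50a009d04000041003c0a10a409f09c02000040003c0a00a300009b02000043003b0000a209d00001000042003b09e0a109c00000000041003b09d0a009b09a04000040003b09c09f00009902000041003a00009c09900000000040003a09a09b0000000400003f00370000000000950700003c00370000000000920900002c00370000000000910900003f00360000980940900100003e003609500009308f0700003d003609400009208e0900003c003609309700008d0600002c003600009600008a0600003f003500009508f0890100003e003509009408e0880100003d003508f09308d0870000003c003508e09208c0860100003b003508d00008b0850400003a003508c0000000840200002c00350000910000830200003f00340000900880820100003e003408908f0870810100003d003408808e0860800700003c003408708d08507f0900003b003408608c08407e0600003a003408508b00007d0900002c003400008a00007a0900003f00330000890810790100003e00330820880800780100003d003308108707f0770100003c003308008607e0760700003b003307f08507d0750900003a003307e0840000740600003600330000000000720600003400330000000000700600002c003300008300006e0600003f003200008207806d0100003e003207908107706c0100003d003207808007606b0100003c003207707f07506a0100003b003207607e0740690700003a003207507d07306809000039003207400000006709000036003200007c0710640900003500320720000700630a000034003207107b06f0620a00003300320700000000610900002c003200007a0000000900003f003100007906c0000100003e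003106d07806b0000800003d003106c07706a0600800003c003106b07606905f0800003b003106a07506805e0800003a003106907406705d00000039003106807306600000000038003106700006500000000037003106600006405c00000036003106507206305b00000035003106407106205a00000034003106307006105900000033003106206f0000580000003d003000006b05f0560100003c003006006a05e0550100003b003005f06905d0540100003a003005e06800005307000037003000006505b05006000036003005c06405a04f06000035003005b06305904e06000034003005a06205804d06000033003005906100004c0600002c003000000000004b0600003d002f00006005504a0100003c002f05605f0540490100003b002f05505e0530480100003a002f05405d05204701000039002f05300005104604000038002f05200005004502000037002f05105c04f04402000036002f05005b04e04302000035002f04f05a04d04202000034002f04e05904c04102000033002f04d0580000400200002c002f00005700003f0200003d002e00005604903e0100003c002e04a05504803d0100003b002e04905404703c0100003a002e04805304603b01000039002e04705204503a07000038002e04605104403909000037002e04505004303809000036002e04404f04203709000035002e04304e0410360a000034002e04204d0400350a000033002e04104c0000340900002c002e00004b0000000900003d002d00004a03d0330100003c002d03e04903c0320100003b002d03d04803b0310100003a002d03c04703a03001000039002d03b04603902f01000038002d03a04503802e07000037002d03904403702d06000036002d03804303602c06000035002d03704203502b06000034002d03604103402a06000033002d0350400000290600003d002c00003e0320280100003c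002c03303d0310270100003b002c03203c0300260100003a002c03103b02f02501000039002c03003a02e02401000038002c02f03902d02301000037002c02e03802c02205000036002c02d03702b02103000035002c02c03602a02003000034002c02b03502901f03000033002c02a03400001e0300003d002b00003302701c0100003c002b02803202601b0100003b002b02703102501a0100003a002b02603002401901000039002b02502f02301801000038002b02402e02201701000037002b02302d02101600000036002b02202c02001504000035002b02102b01f01402000034002b02002a01e01302000033002b01f02901d01202000032002b01e0000000110200003d002a00002801b0100100003c002a01c02701a00f0100003b002a01b02601900e0100003a002a01a02501800d01000039002a01902401700001000038002a01802301600001000037002a01702201500000000036002a01602101400c07000035002a01502001300b0a000034002a01401f0120000a000033002a01301e01100009000032002a01201d0000000900003d002900001c00f00a0100003c002901001b00e0090100003b002900f01a00d0080100003a002900e01900000701000036002900001500b00601000035002900c0140000000000003d00280000100090050100003c002800a00f0080040100003b002800900e0070030100003a002800800d00000201000036002800000c0000010100003d002700000a0040000800003c00270050090030000800003b00270040080020000800003a002700300700000008000036002700000600000008000000000000000000000000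

def tightScript : ℕ :=
  0x12107d14c2f00406300c7338c61d86a3a4f01a48d248972308b214841e87b1b8861f8701d4741d8c7338c61a8e93c0692349225c861d5084250c43d1345d1c414fd1a85331cc63a4f014cc7318e93c05331cc63a4f011c5331cce318e93c06911c6931cc63a4f031cc63a4f03dcc7318e93c0c7318e93c0c7318e93c0f031cc63a4f031cc63a4f01b07820488300c7318e93c0c7318e93c0c7318e93c0c7318e93c06c31cc63a4f031cc63a4f031cc63a4f02382205cc031cc63b8d43a4f031cc63a4f031cc63a4f042c6302c2231cc63b8d43a4f031cc63a4f031cc63a4f000807300c7318e93c002300c7318e93c0c7318e93c0c7318e93c0c7318e93c0e93c06c1b4e91a86c1b4cd1b06d0892242cc61b06d02ccc42c0b1a4002749e288ab300c72e4ce318bf2e0be2dcc52f4b62d49a02d20330c42f0661946419d0b4886818ccd238d43c06b180561283e0cc280701031cc6334d41a4f00140a17c551243d0c82706c0f31cc6334d41a4f001009178541203c0c4260680e1b46c1a4f000c5e150480f0310981a0380801c0d449163a0ee0641805c25090231e48222478204882408f0c03b3dcfe1dc2f2004714cae0b91b254762c4ad2a8b02b0b32bcb2264a62849c294a026ca9290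9f2a0a329c98250932349225c872308622c851fc841f8751d0731c47042c61350e93c0692349225c531bc741a0221c06248d244952649d284851f4690e428b44450d2e915440c12ed19450c83091e460cf324c3474d5340ca36cd6344cb370d7348dd360d3378d937cda41ce0388e1390e33fce6394ea39cf13acf83c9003e4ec404f53cced3e8f4408fb40cfc419043f4f60e85d1705b16859160962448a1ec8320c7a1ec7c1c8701b8573bc4b0fc521445013c4e1344c0741f078290d02b0a846100390d445104380d84410843044370b4120b02004c210581403015

/-- The tiles of `Teval` in the order in which they are named at the end of the last case
analysis. -/
def namedList : List (TileType Glue) :=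
  [17, 6, 20, 0, 11, 8, 9, 19, 13, 15, 16, 10, 7, 18, 14, 3, 4, 12, 1, 2, 5].map fun i => tevalList.getD i ⟨.F, .F, .F, .F, 0⟩

def namedTile (u : ℕ) : TileType Glue := namedList.getD (u - 1) ⟨.F, .F, .F, .F, 0⟩

/-- All nodes with the same label are in the same class. -/
def labelsOk (lab : ℕ → Glue) (C : List ℕ) : Bool :=
  -- As `u` starts from 0, the two nodes of the name `u + 1` are `u + 1` and `u + 33`. A glue not
  -- used in this direction is admitted by the second alternative.
  [Glue.F, .T, .f, .t, .s, .c, .n, .v].all fun g => (C.any fun m => allBelow (fun u =>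
    (decide (lab (u + 1) ≠ g) || m.testBit (u + 1)) &&
      (decide (lab (u + 33) ≠ g) || m.testBit (u + 33))) 21) ||
    allBelow (fun u => decide (lab (u + 1) ≠ g) && decide (lab (u + 33) ≠ g)) 21

/-- The names are those of the tiles of `Teval`, and the labels are as in `Teval`. -/
def isTeval (cols H V : List ℕ) : Bool :=
  decide (cols = colorList (fun u => (namedTile u).color) 21) &&
    (labelsOk (labH namedTile) H && labelsOk (labV namedTile) V)

/-- The rectangles `(c, x, w, y, h)` of color `c`, in columns `x, …, x + w - 1` and rows
`y, …, y + h - 1`. -/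
def rectangles : List (ℕ × ℕ × ℕ × ℕ × ℕ) :=
  [(10, 55, 1, 2, 25), (9, 55, 1, 27, 25), (10, 55, 1, 52, 1), (6, 54, 1, 1, 53), (6, 54, 1, 0, 54),
    (2, 53, 1, 0, 59),
    (10, 46, 1, 2, 25), (9, 46, 1, 27, 25), (10, 46, 1, 52, 1), (6, 45, 1, 1, 53), (3, 44, 1, 0, 55),
    (10, 42, 1, 2, 25), (9, 42, 1, 27, 1), (0, 6, 36, 1, 53), (1, 14, 25, 54, 1), (8, 39, 1, 54, 1),
    (4, 53, 1, 59, 1), (5, 44, 1, 55, 1), (7, 42, 1, 54, 1)]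

/-- Columns of `Init` and bottom rows of the white diagonals, ordered by the words that they
show. -/
def whiteInstances : List (ℕ × ℕ) :=
  [(79, 77), (131, 121), (103, 97), (159, 145), (67, 67), (117, 109), (91, 87), (145, 133), (73, 72),
    (124, 115), (97, 92), (152, 139), (61, 62), (110, 103), (85, 82), (138, 127)]

/-- Columns of `Init` and bottom rows of the black diagonals, ordered by the words that they
show. -/
def blackInstances : List (ℕ × ℕ) :=
  [(263, 233), (215, 193), (239, 213), (187, 169), (251, 223), (201, 181), (227, 203), (173, 157),
    (257, 228), (208, 187), (233, 208), (180, 163), (245, 218), (194, 175), (221, 198), (166, 151)]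

/-- Check the colors of the instance of a diagonal with `Init` in column `x` above row `y`. -/
def instanceOk (G w d k x y : ℕ) : Bool :=
  and (rectOk G 6 x 1 y 5) <| and (rectOk G 9 (x + 1) 1 y 1) <|
  and (allBelow (fun r => rectOk G d (x - 4 + r) 1 (y + 1 + r) 1) 4) <|
  and (allBelow (fun r => rectOk G w (x - 3 + r) (3 - r) (y + r) 2) 3)
    -- Bit `r` of `k` is the signal leaving in row `y + 1 + r`: 9 is red, for `F`, and 10 is blue,
    -- for `T`.
    (allBelow (fun r => rectOk G (9 + k / 2 ^ r % 2) (x + 1) 1 (y + 1 + r) 1) 4)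

def instancesOk (G w d : ℕ) (l : List (ℕ × ℕ)) : Bool :=
  allBelow (fun k => instanceOk G w d k (l.getD k (0, 0)).1 (l.getD k (0, 0)).2) 16

/-- Compare the packed pattern with the data on which the proof relies. -/
def dataOk (G : ℕ) : Bool :=
  and (allBelow (entryOk stairsTable G) 1024) <|
  and (allBelow (entryOk whiteDiagonalTable G) 1024) <|
  and (allBelow (entryOk blackDiagonalTable G) 1024) <|
  and (allBelow (entryOk cornerTable G) 1024) <|
  and (allBelow (entryOk tightTable G) 1024) <|
  and (rectangles.all fun p => rectOk G p.1 p.2.1 p.2.2.1 p.2.2.2.1 p.2.2.2.2) <|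
  and (instancesOk G 2 4 whiteInstances) (instancesOk G 3 5 blackInstances)

/-! ### Kernel evaluation of the data and of the five searches -/

theorem gadget_dataOk : packRows 265 gadgetRows 0 dataOk = true := by
  decide +kernel

/-- The final test is constantly `false`, so no leaf is accepted: every case ends in a clash or
exceeds the budget. The same holds for the next three searches. -/
theorem stairs_run : run stairsTable stairsBudget (fun _ _ _ => false) 1000 0 0 0 [] [] []
    stairsScript (fun _ => true) = true := by
  decide +kernel

theorem whiteDiagonal_run : run whiteDiagonalTable (diagonalBudget 2 4) (fun _ _ _ => false) 1000
    0 0 0 [] [] [] whiteDiagonalScript (fun _ => true) = true := by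
  decide +kernel

theorem blackDiagonal_run : run blackDiagonalTable (diagonalBudget 3 5) (fun _ _ _ => false) 1000
    0 0 0 [] [] [] blackDiagonalScript (fun _ => true) = true := by
  decide +kernel

/-- With three cyan tiles, the minima in `cornerBudget` add up to 20, which leaves one tile to
spare. -/
theorem corner_run : run cornerTable cornerBudget (fun _ _ _ => false) 1000 0 0 0 [] [] []
    cornerScript (fun _ => true) = true := by
  decide +kernel

/-- With four cyan tiles, the minima in `fullBudget` add up to 21. Only the split between CE and
yellow is left open by the counting, and the search settles it. -/
theorem tight_run : run tightTable (fullBudget 4) isTeval 1000 0 0 0 [] [] [] tightScript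
    (fun _ => true) = true := by
  decide +kernel

/-! ### Counting tiles by running through columns and rows -/

/-- The tiles of color `c`. -/
def tiles (T : Finset (TileType L)) (c : ℕ) : Finset (TileType L) := T.filter (·.color = c)

theorem mem_tiles {T : Finset (TileType L)} {c : ℕ} {t : TileType L} :
    t ∈ tiles T c ↔ t ∈ T ∧ t.color = c := Finset.mem_filter

theorem Directed.eq {T : Finset (TileType L)} (hT : Directed T) {t t' : TileType L} (ht : t ∈ T)
    (ht' : t' ∈ T) (hw : t.west = t'.west) (hs : t.south = t'.south) : t = t' := by
  by_contra h
  have := hT t ht t' ht' h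
  tauto

theorem GadgetTiling.mem_tiles {T : Finset (TileType L)} {τ : ℕ → ℕ → TileType L}
    (hτ : GadgetTiling T τ) {c x y : ℕ} (hx : x < 265) (hy : y < 240)
    (h : gadgetColor x y = c) : τ x y ∈ tiles T c :=
  RTAS.mem_tiles.2 ⟨hτ.mem x hx y hy, (hτ.color x hx y hy).trans h⟩

theorem GadgetTiling.not_mem_tiles {T : Finset (TileType L)} {τ : ℕ → ℕ → TileType L}
    (hτ : GadgetTiling T τ) {c c' x y : ℕ} (hx : x < 265) (hy : y < 240)
    (h : gadgetColor x y = c') (hc : c' ≠ c) : τ x y ∉ tiles T c := fun hm =>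
  hc (h.symm.trans ((hτ.color x hx y hy).symm.trans (RTAS.mem_tiles.1 hm).2))

theorem HasRect.eq {c x w y h : ℕ} (H : HasRect c x w y h) {x' y' : ℕ} (h₁ : x ≤ x')
    (h₂ : x' < x + w) (h₃ : y ≤ y') (h₄ : y' < y + h) : gadgetColor x' y' = c := by
  have := H (x' - x) (by omega) (y' - y) (by omega)
  rwa [show x + (x' - x) = x' by omega, show y + (y' - y) = y' by omega] at this

/-- A repeated state among the first `n` would propagate in lockstep until the later copy reaches `s
n`, which would then lie in `S`. So these states are distinct. -/
theorem le_card_of_autonomous {α : Type*} {s : ℕ → α} {S : Finset α} {n : ℕ}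
    (hS : ∀ i < n, s i ∈ S) (hn : s n ∉ S)
    (hs : ∀ i < n, ∀ j < n, s i = s j → s (i + 1) = s (j + 1)) : n ≤ S.card := by
  have key : ∀ i j, i < j → j < n → s i ≠ s j := by
    intro i j hij hj h
    have : ∀ d, j + d ≤ n → s (i + d) = s (j + d) := by
      intro d
      induction d with
      | zero => exact fun _ => h
      | succ d ih => exact fun hd => hs (i + d) (by omega) (j + d) (by omega) (ih (by omega))
    have h' := this (n - j) (by omega)
    rw [show j + (n - j) = n by omega] at h'
    exact hn (h' ▸ hS _ (by omega))
  have := Finset.card_le_card_of_injOn (s := Finset.range n) (t := S) s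
    (fun i hi => hS i (Finset.mem_range.1 hi)) (fun i hi j hj h => by
      rcases lt_trichotomy i j with hij | hij | hij
      · exact absurd h (key i j hij (Finset.mem_range.1 hj))
      · exact hij
      · exact absurd h.symm (key j i hij (Finset.mem_range.1 hi)))
  simpa using this

/-- The pair of `aux i` and the tile in row `a + i` is a state: `aux` supplies the next west label,
the present tile the next south label. -/
theorem column_le {T : Finset (TileType L)} {τ : ℕ → ℕ → TileType L} (hT : Directed T)
    (hτ : GadgetTiling T τ) {β : Type*} {S : Finset β} {aux : ℕ → β} {x a n c : ℕ} (hx : x < 265)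
    (ha : a + n < 240) (hc : ∀ i < n, τ x (a + i) ∈ tiles T c) (hc' : τ x (a + n) ∉ tiles T c)
    (hS : ∀ i < n, aux i ∈ S)
    (h : ∀ i < n, ∀ j < n, aux i = aux j → aux (i + 1) = aux (j + 1) ∧
      (τ x (a + (i + 1))).west = (τ x (a + (j + 1))).west) :
    n ≤ S.card * (tiles T c).card := by
  rw [← Finset.card_product]
  refine le_card_of_autonomous (s := fun i => (aux i, τ x (a + i)))
    (fun i hi => Finset.mem_product.2 ⟨hS i hi, hc i hi⟩)
    (fun h => hc' (Finset.mem_product.1 h).2) fun i hi j hj hij => ?_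
  obtain ⟨h₁, h₂⟩ := Prod.mk.inj hij
  obtain ⟨h₃, h₄⟩ := h i hi j hj h₁
  refine Prod.ext h₃ (hT.eq (hτ.mem _ hx _ (by omega)) (hτ.mem _ hx _ (by omega)) h₄ ?_)
  rw [← add_assoc, ← add_assoc, ← hτ.ver _ _ hx (by omega), ← hτ.ver _ _ hx (by omega), h₂]

/-- The bounds for a column of `Init` west of a column of 25 blue and 25 red cells, if the labels
on the west of the column of `Init` have period `m`. -/
theorem init_column_le {T : Finset (TileType L)} {τ : ℕ → ℕ → TileType L} (hT : Directed T)
    (hτ : GadgetTiling T τ) {X m : ℕ} (hm : 0 < m) (hX : X + 1 < 265)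
    (hi : HasRect init X 1 1 53) (hb : HasRect blue (X + 1) 1 2 25)
    (hr : HasRect red (X + 1) 1 27 25) (hb' : HasRect blue (X + 1) 1 52 1)
    (hW : ∀ y y', y ≤ 53 → y' ≤ 53 → y % m = y' % m → (τ X y).west = (τ X y').west) :
    25 ≤ m * (tiles T init).card * (tiles T blue).card ∧
      25 ≤ m * (tiles T init).card * (tiles T red).card := by
  have key : ∀ a c, 2 ≤ a → a + 25 ≤ 52 → (∀ i < 25, τ (X + 1) (a + i) ∈ tiles T c) →
      τ (X + 1) (a + 25) ∉ tiles T c → 25 ≤ m * (tiles T init).card * (tiles T c).card := by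
    intro a c ha ha' hc hc'
    -- The row modulo `m` together with the Init tile evolves by itself: the residue fixes the next
    -- west label and the Init tile below gives the south label.
    have := column_le hT hτ (S := Finset.range m ×ˢ tiles T init)
      (aux := fun i => ((a + i) % m, τ X (a + i))) hX (by omega) hc hc'
      (fun i hi' => Finset.mem_product.2 ⟨Finset.mem_range.2 (Nat.mod_lt _ hm),
        hτ.mem_tiles (by omega) (by omega) (hi.eq le_rfl (by omega) (by omega) (by omega))⟩)
      (fun i hi' j hj' hij => by
        obtain ⟨h₁, h₂⟩ := Prod.mk.inj hij
        have h₃ : (a + (i + 1)) % m = (a + (j + 1)) % m := by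
          rw [← add_assoc, ← add_assoc]; exact Nat.ModEq.add_right 1 h₁
        have h₄ : τ X (a + (i + 1)) = τ X (a + (j + 1)) := by
          refine hT.eq (hτ.mem _ (by omega) _ (by omega)) (hτ.mem _ (by omega) _ (by omega))
            (hW _ _ (by omega) (by omega) h₃) ?_
          rw [← add_assoc, ← add_assoc, ← hτ.ver _ _ (by omega) (by omega),
            ← hτ.ver _ _ (by omega) (by omega), h₂]
        refine ⟨Prod.ext h₃ h₄, ?_⟩
        rw [← hτ.hor _ _ hX (by omega), ← hτ.hor _ _ hX (by omega), h₄])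
    simpa using this
  constructor
  · exact key 2 blue le_rfl (by norm_num)
      (fun i hi => hτ.mem_tiles hX (by omega) (hb.eq le_rfl (by omega) (by omega) (by omega)))
      (hτ.not_mem_tiles hX (by omega)
        (hr.eq (y' := 27) le_rfl (by omega) (by omega) (by omega)) (by decide))
  · exact key 27 red (by norm_num) le_rfl
      (fun i hi => hτ.mem_tiles hX (by omega) (hr.eq le_rfl (by omega) (by omega) (by omega)))
      (hτ.not_mem_tiles hX (by omega)
        (hb'.eq (y' := 52) le_rfl (by omega) (by omega) (by omega)) (by decide))

/-- A sequence in a set of at most two elements in which each term determines the preceding one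
has period 2, up to its last term. -/
theorem two_periodic {α : Type*} {S : Finset α} (hS : S.card ≤ 2) {t : ℕ → α} {M : ℕ}
    (ht : ∀ y ≤ M, t y ∈ S) (h : ∀ y < M, ∀ y' < M, t (y + 1) = t (y' + 1) → t y = t y') :
    ∀ y y', y < M → y' < M → y % 2 = y' % 2 → t y = t y' := by
  have step : ∀ y, y + 3 ≤ M → t y = t (y + 2) := by
    intro y hy
    -- Two of the three terms after `t y` coincide; stepping back from them gives the claim.
    by_cases h₁ : t (y + 1) = t (y + 2)
    · exact (h _ (by omega) _ (by omega) h₁).trans h₁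
    by_cases h₂ : t (y + 1) = t (y + 3)
    · exact h _ (by omega) _ (by omega) h₂
    by_cases h₃ : t (y + 2) = t (y + 3)
    · exact absurd (h _ (by omega) _ (by omega) h₃) h₁
    exact absurd hS (not_le.2 (Finset.two_lt_card.2 ⟨_, ht (y + 1) (by omega), _,
      ht (y + 2) (by omega), _, ht (y + 3) (by omega), h₁, h₂, h₃⟩))
  have steps : ∀ k y, y + 2 * k < M → t y = t (y + 2 * k) := by
    intro k
    induction k with
    | zero => exact fun y _ => rfl
    | succ k ih =>
      intro y hy
      rw [ih y (by omega), step (y + 2 * k) (by omega)]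
      congr 1
  intro y y' hy hy' hyy
  rcases le_total y y' with hle | hle
  · rw [steps ((y' - y) / 2) y (by omega), show y + 2 * ((y' - y) / 2) = y' by omega]
  · rw [steps ((y - y') / 2) y' (by omega), show y' + 2 * ((y - y') / 2) = y by omega]

theorem eq_of_card_le_one {α : Type*} {S : Finset α} (hS : S.card ≤ 1) {a b : α} (ha : a ∈ S)
    (hb : b ∈ S) : a = b :=
  Finset.card_le_one.1 hS a ha b hb

/-- A function that is not injective on a set of at most two elements is constant on it. -/
theorem eq_of_not_injOn {α β : Type*} {S : Finset α} (hS : S.card ≤ 2) {f : α → β}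
    (hf : ¬ ∀ a ∈ S, ∀ b ∈ S, f a = f b → a = b) : ∀ a ∈ S, ∀ b ∈ S, f a = f b := by
  push Not at hf
  obtain ⟨a, ha, b, hb, hab, hne⟩ := hf
  have key : ∀ c ∈ S, f c = f a := by
    intro c hc
    by_contra h
    refine absurd hS (not_le.2 (Finset.two_lt_card.2 ⟨a, ha, b, hb, c, hc, hne, ?_, ?_⟩))
    · rintro rfl; exact h rfl
    · rintro rfl; exact h hab.symm
  exact fun c hc d hd => (key c hc).trans (key d hd).symm

/-- There are two tiles of a color that fills the column west of a column of `Init`, unless there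
are many tiles of the colors `Init`, red and blue. -/
theorem init_column_le_of_card_le_one {T : Finset (TileType L)} {τ : ℕ → ℕ → TileType L}
    (hT : Directed T) (hτ : GadgetTiling T τ) {X w : ℕ} (hX : X + 2 < 265)
    (hw : HasRect w X 1 0 54) (hi : HasRect init (X + 1) 1 1 53)
    (hb : HasRect blue (X + 2) 1 2 25) (hr : HasRect red (X + 2) 1 27 25)
    (hb' : HasRect blue (X + 2) 1 52 1) (hW : (tiles T w).card ≤ 1) :
    25 ≤ (tiles T init).card * (tiles T blue).card ∧
      25 ≤ (tiles T init).card * (tiles T red).card := by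
  have := init_column_le hT hτ (X := X + 1) one_pos hX hi hb hr hb' fun y y' hy hy' _ => by
    rw [← hτ.hor _ _ (by omega) (by omega), ← hτ.hor _ _ (by omega) (by omega),
      eq_of_card_le_one hW (hτ.mem_tiles (x := X) (y := y) (by omega) (by omega)
        (hw.eq le_rfl (by omega) (by omega) (by omega))) (hτ.mem_tiles (x := X) (y := y')
        (by omega) (by omega) (hw.eq le_rfl (by omega) (by omega) (by omega)))]
  simpa using this

/-- A single Init tile in the whole column forces constant west labels, so the period is 1. -/
theorem init_column_le_of_card_init {T : Finset (TileType L)} {τ : ℕ → ℕ → TileType L}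
    (hT : Directed T) (hτ : GadgetTiling T τ) {X : ℕ} (hX : X + 1 < 265)
    (hi : HasRect init X 1 0 54) (hb : HasRect blue (X + 1) 1 2 25)
    (hr : HasRect red (X + 1) 1 27 25) (hb' : HasRect blue (X + 1) 1 52 1)
    (hI : (tiles T init).card ≤ 1) :
    25 ≤ (tiles T init).card * (tiles T blue).card ∧
      25 ≤ (tiles T init).card * (tiles T red).card := by
  have := init_column_le hT hτ (X := X) one_pos hX
    (fun i hi' j hj => hi.eq (by omega) (by omega) (by omega) (by omega)) hb hr hb'
    fun y y' hy hy' _ => by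
      rw [eq_of_card_le_one hI (hτ.mem_tiles (x := X) (y := y) (by omega) (by omega)
        (hi.eq le_rfl (by omega) (by omega) (by omega))) (hτ.mem_tiles (x := X) (y := y')
        (by omega) (by omega) (hi.eq le_rfl (by omega) (by omega) (by omega)))]
  simpa using this

/-- The bounds for the rectangle of cyan cells in `LB4`. -/
theorem cyan_le {T : Finset (TileType L)} {τ : ℕ → ℕ → TileType L} (hT : Directed T)
    (hτ : GadgetTiling T τ) (hc : HasRect cyan 6 36 1 53) (hb : HasRect blue 42 1 2 25)
    (hr : HasRect red 42 1 27 1) (he : HasRect CE 14 25 54 1) (hy : HasRect yellow 39 1 54 1)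
    (hC : (tiles T cyan).card ≤ 2) :
    25 ≤ (tiles T blue).card ∨ 25 ≤ 2 * (tiles T CE).card := by
  have hmem : ∀ x y, 6 ≤ x → x < 42 → 1 ≤ y → y < 54 → τ x y ∈ tiles T cyan :=
    fun x y h₁ h₂ h₃ h₄ => hτ.mem_tiles (by omega) (by omega)
      (hc.eq (by omega) (by omega) (by omega) (by omega))
  -- If east labels separate the cyan tiles, each tile of row 53 determines its western neighbor;
  -- the row has period 2, and so have the south labels of the 25 CE cells above it. Otherwise all
  -- cyan tiles have one east label, and the 25 blue cells in column 42 receive a constant input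
  -- from the west.
  by_cases hE : ∀ t ∈ tiles T cyan, ∀ t' ∈ tiles T cyan, t.east = t'.east → t = t'
  · right
    have per := two_periodic hC (t := fun x => τ (6 + x) 53) (M := 35)
      (fun x hx => hmem _ _ (by omega) (by omega) (by omega) (by omega))
      (fun x hx x' hx' h => hE _ (hmem _ _ (by omega) (by omega) (by omega) (by omega)) _
        (hmem _ _ (by omega) (by omega) (by omega) (by omega)) (by
          rw [hτ.hor _ _ (by omega) (by omega), hτ.hor _ _ (by omega) (by omega)]
          exact congrArg TileType.west h))
    have := le_card_of_autonomous (s := fun i => ((14 + i) % 2, τ (14 + i) 54))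
      (S := Finset.range 2 ×ˢ tiles T CE) (n := 25)
      (fun i hi => Finset.mem_product.2 ⟨Finset.mem_range.2 (Nat.mod_lt _ two_pos),
        hτ.mem_tiles (by omega) (by omega) (he.eq (by omega) (by omega) (by omega) (by omega))⟩)
      (fun h => hτ.not_mem_tiles (c := CE) (x := 39) (y := 54) (by omega) (by omega)
        (hy.eq (by omega) (by omega) (by omega) (by omega)) (by decide)
        (Finset.mem_product.1 h).2)
      (fun i hi j hj hij => by
        obtain ⟨h₁, h₂⟩ := Prod.mk.inj hij
        refine Prod.ext (by simp only; omega)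
          (hT.eq (hτ.mem _ (by omega) _ (by omega)) (hτ.mem _ (by omega) _ (by omega)) ?_ ?_)
        · simp only
          rw [← add_assoc, ← add_assoc, ← hτ.hor _ _ (by omega) (by omega),
            ← hτ.hor _ _ (by omega) (by omega), h₂]
        · simp only
          rw [← hτ.ver _ 53 (by omega) (by omega), ← hτ.ver _ 53 (by omega) (by omega)]
          have := per (9 + i) (9 + j) (by omega) (by omega) (by omega)
          rw [show 14 + (i + 1) = 6 + (9 + i) by omega, show 14 + (j + 1) = 6 + (9 + j) by omega,
            this])
    simpa using this
  · left
    have hE := eq_of_not_injOn hC hE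
    have := column_le hT hτ (S := {()}) (aux := fun _ => ()) (x := 42) (a := 2) (n := 25)
      (c := blue) (by omega) (by omega)
      (fun i hi => hτ.mem_tiles (by omega) (by omega)
        (hb.eq (by omega) (by omega) (by omega) (by omega)))
      (hτ.not_mem_tiles (by omega) (by omega)
        (hr.eq (by omega) (by omega) (by omega) (by omega)) (by decide))
      (fun _ _ => by simp) (fun i hi j hj _ => ⟨rfl, by
        rw [← hτ.hor 41 _ (by omega) (by omega), ← hτ.hor 41 _ (by omega) (by omega)]
        exact hE _ (hmem _ _ (by omega) (by omega) (by omega) (by omega)) _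
          (hmem _ _ (by omega) (by omega) (by omega) (by omega))⟩)
    simpa using this

/-- An instance of a diagonal of color `d` above the color `w`, with the column of `Init` in
column `x` above row `y`, that shows the binary digits of `k`. -/
structure HasInstance (w d k x y : ℕ) : Prop where
  lt_x : x + 1 < 265
  le_x : 4 ≤ x
  lt_y : y + 4 < 240
  init : HasRect init x 1 y 5
  red : HasRect red (x + 1) 1 y 1
  diagonal : ∀ r < 4, gadgetColor (x - 4 + r) (y + 1 + r) = d
  below : ∀ r < 3, HasRect w (x - 3 + r) (3 - r) (y + r) 2
  word : ∀ r < 4, gadgetColor (x + 1) (y + 1 + r) = 9 + k / 2 ^ r % 2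

/-- The bounds for 16 diagonals with one tile of the color `d` and one north label of the color
`w`. -/
theorem diagonal_le {T : Finset (TileType L)} {τ : ℕ → ℕ → TileType L} (hT : Directed T)
    (hτ : GadgetTiling T τ) {w d : ℕ} {l : ℕ → ℕ × ℕ}
    (hl : ∀ k < 16, HasInstance w d k (l k).1 (l k).2) (hd : (tiles T d).card ≤ 1)
    (hw : ∀ t ∈ tiles T w, ∀ t' ∈ tiles T w, t.north = t'.north) :
    16 ≤ (tiles T init).card * (tiles T red).card := by
  -- In each row, the only tile of color `d` starts the same sequence in all instances, because the
  -- tiles east of it stand on the constant north label of color `w`. So the Init columns of all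
  -- instances receive the same west labels.
  have diag : ∀ k < 16, ∀ k' < 16, ∀ r < 4, ∀ i, r + i < 4 →
      τ ((l k).1 - 4 + r + i) ((l k).2 + 1 + r) = τ ((l k').1 - 4 + r + i) ((l k').2 + 1 + r) := by
    intro k hk k' hk' r hr i
    have h := hl k hk
    have h' := hl k' hk'
    obtain ⟨b₁, b₂, b₃⟩ := And.intro h.lt_x (And.intro h.le_x h.lt_y)
    obtain ⟨b₁', b₂', b₃'⟩ := And.intro h'.lt_x (And.intro h'.le_x h'.lt_y)
    induction i with
    | zero =>
      exact fun _ => eq_of_card_le_one hd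
        (hτ.mem_tiles (by omega) (by omega) (h.diagonal r hr))
        (hτ.mem_tiles (by omega) (by omega) (h'.diagonal r hr))
    | succ i ih =>
      intro hi
      have ih := ih (by omega)
      refine hT.eq (hτ.mem _ (by omega) _ (by omega)) (hτ.mem _ (by omega) _ (by omega)) ?_ ?_
      · rw [← add_assoc, ← add_assoc, ← hτ.hor _ _ (by omega) (by omega),
          ← hτ.hor _ _ (by omega) (by omega), ih]
      · rw [show (l k).2 + 1 + r = (l k).2 + r + 1 by omega,
          show (l k').2 + 1 + r = (l k').2 + r + 1 by omega, ← hτ.ver _ _ (by omega) (by omega),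
          ← hτ.ver _ _ (by omega) (by omega)]
        exact hw _ (hτ.mem_tiles (by omega) (by omega)
            ((h.below r (by omega)).eq (by omega) (by omega) (by omega) (by omega))) _
          (hτ.mem_tiles (by omega) (by omega)
            ((h'.below r (by omega)).eq (by omega) (by omega) (by omega) (by omega)))
  -- Given these inputs, the bottom Init tile and the bottom red tile determine both columns
  -- upwards, hence the word. So 16 words need 16 such pairs.
  have inj : ∀ k < 16, ∀ k' < 16, τ (l k).1 (l k).2 = τ (l k').1 (l k').2 →
      τ ((l k).1 + 1) (l k).2 = τ ((l k').1 + 1) (l k').2 → k = k' := by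
    intro k hk k' hk' e₁ e₂
    have h := hl k hk
    have h' := hl k' hk'
    obtain ⟨b₁, b₂, b₃⟩ := And.intro h.lt_x (And.intro h.le_x h.lt_y)
    obtain ⟨b₁', b₂', b₃'⟩ := And.intro h'.lt_x (And.intro h'.le_x h'.lt_y)
    have key : ∀ r ≤ 4, τ (l k).1 ((l k).2 + r) = τ (l k').1 ((l k').2 + r) ∧
        τ ((l k).1 + 1) ((l k).2 + r) = τ ((l k').1 + 1) ((l k').2 + r) := by
      intro r
      induction r with
      | zero => exact fun _ => ⟨e₁, e₂⟩
      | succ r ih =>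
        intro hr
        obtain ⟨i₁, i₂⟩ := ih (by omega)
        have e₃ : τ (l k).1 ((l k).2 + (r + 1)) = τ (l k').1 ((l k').2 + (r + 1)) := by
          refine hT.eq (hτ.mem _ (by omega) _ (by omega)) (hτ.mem _ (by omega) _ (by omega)) ?_ ?_
          · have e := diag k hk k' hk' r (by omega) (3 - r) (by omega)
            have e := congrArg TileType.east e
            rw [hτ.hor _ _ (by omega) (by omega), hτ.hor _ _ (by omega) (by omega),
              show (l k).1 - 4 + r + (3 - r) + 1 = (l k).1 by omega,
              show (l k').1 - 4 + r + (3 - r) + 1 = (l k').1 by omega, add_right_comm,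
              add_right_comm _ 1 r] at e
            exact e
          · rw [← add_assoc, ← add_assoc, ← hτ.ver _ _ (by omega) (by omega),
              ← hτ.ver _ _ (by omega) (by omega), i₁]
        refine ⟨e₃,
          hT.eq (hτ.mem _ (by omega) _ (by omega)) (hτ.mem _ (by omega) _ (by omega)) ?_ ?_⟩
        · rw [← hτ.hor _ _ (by omega) (by omega), ← hτ.hor _ _ (by omega) (by omega), e₃]
        · rw [← add_assoc, ← add_assoc, ← hτ.ver _ _ (by omega) (by omega),
            ← hτ.ver _ _ (by omega) (by omega), i₂]
    have bits : ∀ r < 4, k / 2 ^ r % 2 = k' / 2 ^ r % 2 := by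
      intro r hr
      have e := congrArg TileType.color (key (r + 1) (by omega)).2
      rw [hτ.color _ (by omega) _ (by omega), hτ.color _ (by omega) _ (by omega),
        show (l k).2 + (r + 1) = (l k).2 + 1 + r by omega,
        show (l k').2 + (r + 1) = (l k').2 + 1 + r by omega, h.word r hr, h'.word r hr] at e
      omega
    have b0 := bits 0 (by norm_num)
    have b1 := bits 1 (by norm_num)
    have b2 := bits 2 (by norm_num)
    have b3 := bits 3 (by norm_num)
    norm_num at b0 b1 b2 b3
    omega
  rw [← Finset.card_product]
  have := Finset.card_le_card_of_injOn (s := Finset.range 16)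
    (t := tiles T RTAS.init ×ˢ tiles T RTAS.red)
    (fun k => (τ (l k).1 (l k).2, τ ((l k).1 + 1) (l k).2))
    (fun k hk => by
      have h := hl k (Finset.mem_range.1 hk)
      obtain ⟨b₁, b₂, b₃⟩ := And.intro h.lt_x (And.intro h.le_x h.lt_y)
      exact Finset.mem_product.2 ⟨hτ.mem_tiles (by omega) (by omega)
          (h.init.eq (by omega) (by omega) (by omega) (by omega)),
        hτ.mem_tiles (by omega) (by omega)
          (h.red.eq (by omega) (by omega) (by omega) (by omega))⟩)
    (fun k hk k' hk' h => by
      obtain ⟨h₁, h₂⟩ := Prod.mk.inj h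
      exact inj k (Finset.mem_range.1 hk) k' (Finset.mem_range.1 hk') h₁ h₂)
  simpa using this

/-- The bounds for the diagonals if there are just one tile of color `d` and two tiles of color
`w`. -/
theorem diagonal_le_of_card_le {T : Finset (TileType L)} {τ : ℕ → ℕ → TileType L}
    (hT : Directed T) (hτ : GadgetTiling T τ) {w d X : ℕ} {l : ℕ → ℕ × ℕ}
    (hl : ∀ k < 16, HasInstance w d k (l k).1 (l k).2) (hX : X + 2 < 265)
    (hw : HasRect w X 1 0 55) (hi : HasRect init (X + 1) 1 1 53)
    (hb : HasRect blue (X + 2) 1 2 25) (hr : HasRect red (X + 2) 1 27 25)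
    (hb' : HasRect blue (X + 2) 1 52 1) (hd : (tiles T d).card ≤ 1)
    (hW : (tiles T w).card ≤ 2) :
    25 ≤ 2 * (tiles T init).card * (tiles T blue).card ∨
      16 ≤ (tiles T init).card * (tiles T red).card := by
  -- Separating north labels give the column `X` of color `w` period 2, which is passed on to the
  -- Init column. Otherwise the north label is constant on color `w`, as required for `diagonal_le`.
  by_cases hN : ∀ t ∈ tiles T w, ∀ t' ∈ tiles T w, t.north = t'.north → t = t'
  · left
    have hmem : ∀ y < 55, τ X y ∈ tiles T w := fun y hy => hτ.mem_tiles (by omega) (by omega)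
      (hw.eq (by omega) (by omega) (by omega) (by omega))
    have per := two_periodic hW (t := fun y => τ X y) (M := 54)
      (fun y hy => hmem y (by omega)) (fun y hy y' hy' h =>
        hN _ (hmem y (by omega)) _ (hmem y' (by omega)) (by
          rw [hτ.ver _ _ (by omega) (by omega), hτ.ver _ _ (by omega) (by omega)]
          exact congrArg TileType.south h))
    exact (init_column_le hT hτ (X := X + 1) two_pos hX hi hb hr hb' fun y y' hy hy' h => by
      rw [← hτ.hor _ _ (by omega) (by omega), ← hτ.hor _ _ (by omega) (by omega)]
      exact congrArg TileType.east (per y y' (by omega) (by omega) h)).1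
  · exact .inr (diagonal_le hT hτ hl hd (eq_of_not_injOn hW hN))

/-! ### Numbers of tiles -/

/-- Digits below 256 cause no carry: the lower terms sum to less than `256 ^ c`, the higher ones to
a multiple of `256 ^ (c + 1)`. -/
theorem sum_digits_div {k : ℕ → ℕ} (hk : ∀ i, k i < 256) {c m : ℕ} (hc : c < m) :
    (∑ i ∈ Finset.range m, k i * 256 ^ i) / 256 ^ c % 256 = k c := by
  have low : ∀ c, ∑ i ∈ Finset.range c, k i * 256 ^ i < 256 ^ c := by
    intro c
    induction c with
    | zero => simp
    | succ c ih =>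
      rw [Finset.sum_range_succ, pow_succ]
      have : (k c + 1) * 256 ^ c ≤ 256 * 256 ^ c := Nat.mul_le_mul_right _ (hk c)
      nlinarith
  obtain ⟨m, rfl⟩ := Nat.exists_eq_add_of_lt hc
  rw [add_assoc, Finset.sum_range_add, Finset.sum_range_succ']
  have : ∑ i ∈ Finset.range m, k (c + (i + 1)) * 256 ^ (c + (i + 1)) =
      256 ^ c * (256 * ∑ i ∈ Finset.range m, k (c + (i + 1)) * 256 ^ i) := by
    rw [Finset.mul_sum, Finset.mul_sum]
    exact Finset.sum_congr rfl fun i _ => by ring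
  rw [this, add_zero, mul_comm (k c), ← mul_add, Nat.add_mul_div_left _ _ (by positivity),
    Nat.div_eq_of_lt (low c), zero_add, Nat.mul_add_mod, Nat.mod_eq_of_lt (hk c)]

theorem colorCount_eq (κ : ℕ → ℕ) (n : ℕ) :
    colorCount κ n = ∑ u ∈ Finset.Icc 1 n, 256 ^ κ u := by
  induction n with
  | zero => rfl
  | succ n ih => rw [colorCount, ih, Finset.sum_Icc_succ_top (by omega)]

/-- The number of names of color `c` is at most the number of tiles of color `c`. -/
theorem Naming.digit_le {T : Finset (TileType L)} (hcard : T.card ≤ 21) {n : ℕ}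
    {ν : ℕ → TileType L} (h : Naming T n ν) {c : ℕ} (hc : c < 16) :
    digit (colorCount (fun u => (ν u).color) n) c ≤ (tiles T c).card := by
  have hn := h.le_card
  set k : ℕ → ℕ := fun c => ((Finset.Icc 1 n).filter fun u => (ν u).color = c).card with hk
  have hk256 : ∀ c, k c < 256 := fun c => by
    have : k c ≤ (Finset.Icc 1 n).card := Finset.card_filter_le _ _
    rw [Nat.card_Icc] at this
    omega
  have hsum : colorCount (fun u => (ν u).color) n = ∑ c ∈ Finset.range 16, k c * 256 ^ c := by
    rw [colorCount_eq, ← Finset.sum_fiberwise_of_maps_to (s := Finset.Icc 1 n)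
      (t := Finset.range 16) (g := fun u => (ν u).color) (fun u hu => by
        rw [Finset.mem_Icc] at hu
        exact Finset.mem_range.2 (h.color u hu.1 hu.2))]
    refine Finset.sum_congr rfl fun c _ => ?_
    rw [Finset.sum_congr rfl fun u hu => by rw [(Finset.mem_filter.1 hu).2], Finset.sum_const,
      smul_eq_mul]
  have : digit (colorCount (fun u => (ν u).color) n) c = k c := by
    rw [hsum]; exact sum_digits_div hk256 hc
  rw [this]
  refine Finset.card_le_card_of_injOn ν (fun u hu => ?_) fun u hu v hv huv => ?_
  · obtain ⟨hu, hc⟩ := Finset.mem_filter.1 hu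
    rw [Finset.mem_Icc] at hu
    exact mem_tiles.2 ⟨h.mem u hu.1 hu.2, hc⟩
  · have hu := Finset.mem_Icc.1 (Finset.mem_filter.1 hu).1
    have hv := Finset.mem_Icc.1 (Finset.mem_filter.1 hv).1
    exact h.inj u v hu.1 hu.2 hv.1 hv.2 huv

theorem sum_tiles_le (T : Finset (TileType L)) (m : ℕ) :
    ∑ c ∈ Finset.range m, (tiles T c).card ≤ T.card := by
  classical
  rw [← Finset.card_biUnion]
  · exact Finset.card_le_card fun t ht => by
      obtain ⟨c, -, h⟩ := Finset.mem_biUnion.1 ht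
      exact (mem_tiles.1 h).1
  · intro c _ c' _ hcc
    refine Finset.disjoint_left.2 fun t h h' => hcc ?_
    rw [← (mem_tiles.1 h).2, (mem_tiles.1 h').2]

theorem natMax_le {a b m : ℕ} (ha : a ≤ m) (hb : b ≤ m) : natMax a b ≤ m := by
  change a + (b - a) ≤ m
  omega

theorem stairsBudget_of_le {P : ℕ} {N : ℕ → ℕ} (hP : ∀ c < 16, digit P c ≤ N c)
    (h : N 1 + N 8 ≤ 3) : stairsBudget P = true := by
  have h₁ := hP 1 (by norm_num)
  have h₈ := hP 8 (by norm_num)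
  exact Nat.ble_eq_true_of_le (by change digit P 1 + digit P 8 ≤ 3; omega)

/-- The maxima in the budget are justified by the lower bounds on `N`, since a color has at least
that many tiles even if fewer are named so far. -/
theorem diagonalBudget_of_le {P w d : ℕ} (hw : w < 16) (hd : d < 16) {N : ℕ → ℕ}
    (hP : ∀ c < 16, digit P c ≤ N c) (h : N w + N d + N 6 + N 9 + N 10 ≤ 9) (hNd : N d ≤ 1)
    (h1d : 1 ≤ N d) (h3 : 3 ≤ N w) (h6 : 2 ≤ N 6) (h9 : 1 ≤ N 9) (h10 : 1 ≤ N 10) :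
    diagonalBudget w d P = true := by
  have hw' := natMax_le (hP w hw) h3
  have hd' := natMax_le (hP d hd) h1d
  have h6' := natMax_le (hP 6 (by norm_num)) h6
  have h9' := natMax_le (hP 9 (by norm_num)) h9
  have h10' := natMax_le (hP 10 (by norm_num)) h10
  have hd₁ := hP d hd
  rw [diagonalBudget, Bool.and_eq_true]
  refine ⟨Nat.ble_eq_true_of_le (by omega), Nat.ble_eq_true_of_le ?_⟩
  simp only [Nat.add_eq]
  omega

theorem fullBudget_of_le {P m : ℕ} {N : ℕ → ℕ} (hP : ∀ c < 16, digit P c ≤ N c)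
    (h : N 0 + N 1 + N 2 + N 3 + N 4 + N 5 + N 6 + N 7 + N 8 + N 9 + N 10 ≤ 21) (h0 : m ≤ N 0)
    (h18 : 4 ≤ N 1 + N 8) (h2 : 2 ≤ N 2) (h3 : 2 ≤ N 3) (h4 : 2 ≤ N 4) (h5 : 2 ≤ N 5)
    (h6 : 2 ≤ N 6) (h7 : 1 ≤ N 7) (h9 : 1 ≤ N 9) (h10 : 1 ≤ N 10) : fullBudget m P = true := by
  have h0' := natMax_le (hP 0 (by norm_num)) h0
  have h18' := natMax_le (Nat.add_le_add (hP 1 (by norm_num)) (hP 8 (by norm_num))) h18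
  have h2' := natMax_le (hP 2 (by norm_num)) h2
  have h3' := natMax_le (hP 3 (by norm_num)) h3
  have h4' := natMax_le (hP 4 (by norm_num)) h4
  have h5' := natMax_le (hP 5 (by norm_num)) h5
  have h6' := natMax_le (hP 6 (by norm_num)) h6
  have h7' := natMax_le (hP 7 (by norm_num)) h7
  have h9' := natMax_le (hP 9 (by norm_num)) h9
  have h10' := natMax_le (hP 10 (by norm_num)) h10
  refine Nat.ble_eq_true_of_le ?_
  simp only [Nat.add_eq]
  omega

/-! ### The data about the gadget -/

theorem rectangles_spec : ∀ p ∈ rectangles, HasRect p.1 p.2.1 p.2.2.1 p.2.2.2.1 p.2.2.2.2 := by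
  obtain ⟨G, h, hG⟩ := gadgetColor_of_packRows gadget_dataOk
  simp only [dataOk, Bool.and_eq_true] at h
  exact fun p hp => rectOk_sound hG (List.all_eq_true.1 h.2.2.2.2.2.1 p hp)

theorem instanceOk_sound {G w d k x y : ℕ}
    (hG : ∀ x < 265, ∀ y < 240, colorAt 265 240 G x y = gadgetColor x y)
    (h : instanceOk G w d k x y = true) (hx : 4 ≤ x) : HasInstance w d k x y := by
  simp only [instanceOk, Bool.and_eq_true] at h
  obtain ⟨h₁, h₂, h₃, h₄, h₅⟩ := h
  have b₁ := h₁
  have b₂ := h₂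
  simp only [rectOk, Bool.and_eq_true] at b₁ b₂
  have b₁ := Nat.le_of_ble_eq_true b₁.2.1
  have b₂ := Nat.le_of_ble_eq_true b₂.1
  refine ⟨by omega, hx, by omega, rectOk_sound hG h₁, rectOk_sound hG h₂, fun r hr => ?_,
    fun r hr => rectOk_sound hG (allBelow_iff h₄ r hr), fun r hr => ?_⟩
  · exact (rectOk_sound hG (allBelow_iff h₃ r hr)) 0 one_pos 0 one_pos
  · exact (rectOk_sound hG (allBelow_iff h₅ r hr)) 0 one_pos 0 one_pos

theorem whiteInstances_spec : ∀ k < 16, HasInstance 2 4 k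
    (whiteInstances.getD k (0, 0)).1 (whiteInstances.getD k (0, 0)).2 := by
  obtain ⟨G, h, hG⟩ := gadgetColor_of_packRows gadget_dataOk
  simp only [dataOk, Bool.and_eq_true] at h
  have hx : ∀ k < 16, 4 ≤ (whiteInstances.getD k (0, 0)).1 := by decide
  exact fun k hk => instanceOk_sound hG (allBelow_iff h.2.2.2.2.2.2.1 k hk) (hx k hk)

theorem blackInstances_spec : ∀ k < 16, HasInstance 3 5 k
    (blackInstances.getD k (0, 0)).1 (blackInstances.getD k (0, 0)).2 := by
  obtain ⟨G, h, hG⟩ := gadgetColor_of_packRows gadget_dataOk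
  simp only [dataOk, Bool.and_eq_true] at h
  have hx : ∀ k < 16, 4 ≤ (blackInstances.getD k (0, 0)).1 := by decide
  exact fun k hk => instanceOk_sound hG (allBelow_iff h.2.2.2.2.2.2.2 k hk) (hx k hk)

theorem GadgetTiling.placed {T : Finset (TileType L)} {τ : ℕ → ℕ → TileType L}
    (hτ : GadgetTiling T τ) {table : ℕ} (ht : table = stairsTable ∨ table = whiteDiagonalTable ∨
      table = blackDiagonalTable ∨ table = cornerTable ∨ table = tightTable) :
    ∃ τ', Placed T table τ' := by
  obtain ⟨G, h, hG⟩ := gadgetColor_of_packRows gadget_dataOk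
  simp only [dataOk, Bool.and_eq_true] at h
  obtain ⟨h₁, h₂, h₃, h₄, h₅, -⟩ := h
  rcases ht with rfl | rfl | rfl | rfl | rfl
  · exact ⟨_, placed_of_entryOk hτ hG h₁⟩
  · exact ⟨_, placed_of_entryOk hτ hG h₂⟩
  · exact ⟨_, placed_of_entryOk hτ hG h₃⟩
  · exact ⟨_, placed_of_entryOk hτ hG h₄⟩
  · exact ⟨_, placed_of_entryOk hτ hG h₅⟩

/-- The empty naming is correct for the initial state, and named tiles are distinct, so their
numbers by color are bounded by those in `T`. -/
theorem run_sound_start {T : Finset (TileType L)} {table : ℕ} {τ : ℕ → TileType L}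
    (hT : Directed T) (hcard : T.card ≤ 21) (hτ : Placed T table τ) {bud : ℕ → Bool}
    (hbud : ∀ P, (∀ c < 16, digit P c ≤ (tiles T c).card) → bud P = true)
    {final : List ℕ → List ℕ → List ℕ → Bool} {fuel s : ℕ} {k : ℕ → Bool}
    (h : run table bud final fuel 0 0 0 [] [] [] s k = true) :
    ∃ A n P cols H V ν, Interp T τ A n P cols H V ν ∧ final cols H V = true := by
  have zero : ∀ j, nameAt 0 j = 0 := fun j => by
    change (0 >>> (5 * j)) % 32 = 0
    simp
  refine (run_sound hT hcard hτ (fun n ν hν => hbud _ fun c hc => hν.digit_le hcard hc) h).2 τ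
    ⟨⟨fun u h₁ h₂ => by omega, fun u v h₁ h₂ => by omega, fun u h₁ h₂ => by omega⟩, zero 0,
      fun j hj => absurd (zero j) hj, rfl, rfl, ?_, ?_⟩ <;>
  exact fun m hm => by simp at hm

/-- There are as many tiles of each color as in `Teval`, but there may be other numbers of `CE`
and yellow tiles. -/
theorem card_tiles {T : Finset (TileType L)} {τ : ℕ → ℕ → TileType L} (hT : Directed T)
    (hcard : T.card ≤ 21) (hτ : GadgetTiling T τ) :
    ∀ P, (∀ c < 16, digit P c ≤ (tiles T c).card) → fullBudget 4 P = true := by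
  have rect : ∀ c x w y h, (c, x, w, y, h) ∈ rectangles → HasRect c x w y h :=
    fun c x w y h hp => rectangles_spec _ hp
  have pos : ∀ c x y, gadgetColor x y = c → x < 265 → y < 240 → 1 ≤ (tiles T c).card :=
    fun c x y h hx hy => Finset.card_pos.2 ⟨_, hτ.mem_tiles hx hy h⟩
  have cell : ∀ c x w y h, (c, x, w, y, h) ∈ rectangles → 0 < w → 0 < h → x < 265 → y < 240 →
      1 ≤ (tiles T c).card := fun c x w y h hp hw hh hx hy =>
    pos c x y ((rect c x w y h hp) 0 hw 0 hh) hx hy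
  have hsum := (sum_tiles_le T 11).trans hcard
  simp only [Finset.sum_range_succ, Finset.sum_range_zero, zero_add] at hsum
  have p0 := cell 0 6 36 1 53 (by decide) (by norm_num) (by norm_num) (by norm_num) (by norm_num)
  have p1 := cell 1 14 25 54 1 (by decide) (by norm_num) (by norm_num) (by norm_num) (by norm_num)
  have p2 := cell 2 53 1 0 59 (by decide) (by norm_num) (by norm_num) (by norm_num) (by norm_num)
  have p3 := cell 3 44 1 0 55 (by decide) (by norm_num) (by norm_num) (by norm_num) (by norm_num)
  have p4 := cell 4 53 1 59 1 (by decide) (by norm_num) (by norm_num) (by norm_num) (by norm_num)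
  have p5 := cell 5 44 1 55 1 (by decide) (by norm_num) (by norm_num) (by norm_num) (by norm_num)
  have p6 := cell 6 54 1 1 53 (by decide) (by norm_num) (by norm_num) (by norm_num) (by norm_num)
  have p7 := cell 7 42 1 54 1 (by decide) (by norm_num) (by norm_num) (by norm_num) (by norm_num)
  have p8 := cell 8 39 1 54 1 (by decide) (by norm_num) (by norm_num) (by norm_num) (by norm_num)
  have p9 := cell 9 55 1 27 25 (by decide) (by norm_num) (by norm_num) (by norm_num) (by norm_num)
  have p10 := cell 10 55 1 2 25 (by decide) (by norm_num) (by norm_num) (by norm_num) (by norm_num)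
  have b18 : 4 ≤ (tiles T 1).card + (tiles T 8).card := by
    by_contra hlt
    obtain ⟨τ', hτ'⟩ := hτ.placed (.inl rfl)
    obtain ⟨_, _, _, _, _, _, _, -, h⟩ := run_sound_start hT hcard hτ'
      (fun P hP => stairsBudget_of_le hP (by omega)) stairs_run
    exact absurd h (by simp)
  have w53 := rect 2 53 1 0 59 (by decide)
  have i54 := rect 6 54 1 1 53 (by decide)
  have b55 := rect 10 55 1 2 25 (by decide)
  have r55 := rect 9 55 1 27 25 (by decide)
  have b55' := rect 10 55 1 52 1 (by decide)
  have k44 := rect 3 44 1 0 55 (by decide)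
  have i45 := rect 6 45 1 1 53 (by decide)
  have b46 := rect 10 46 1 2 25 (by decide)
  have r46 := rect 9 46 1 27 25 (by decide)
  have b46' := rect 10 46 1 52 1 (by decide)
  -- The other colors need at least 10 tiles, four of them CE or yellow, which leaves 11. Adding the
  -- two inequalities would give $50 \le i(r+b) \le 30$.
  have small : ∀ i r b : ℕ, i + r + b ≤ 11 → 25 ≤ i * b ∧ 25 ≤ i * r → False := by
    intro i r b h ⟨h₁, h₂⟩
    have : i ≤ 11 := by omega
    interval_cases i <;> omega
  have l6 : 2 ≤ (tiles T 6).card := by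
    by_contra hlt
    exact small (tiles T 6).card (tiles T 9).card (tiles T 10).card (by omega) (init_column_le_of_card_init hT hτ (X := 54) (by norm_num)
      (rect 6 54 1 0 54 (by decide)) b55 r55 b55' (show (tiles T 6).card ≤ 1 by omega))
  have l2 : 2 ≤ (tiles T 2).card := by
    by_contra hlt
    exact small (tiles T 6).card (tiles T 9).card (tiles T 10).card (by omega) (init_column_le_of_card_le_one hT hτ (X := 53) (by norm_num)
      (fun i hi j hj => w53 i hi j (by omega)) i54 b55 r55 b55' (by omega))
  have l3 : 2 ≤ (tiles T 3).card := by
    by_contra hlt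
    exact small (tiles T 6).card (tiles T 9).card (tiles T 10).card (by omega) (init_column_le_of_card_le_one hT hτ (X := 44) (by norm_num)
      (fun i hi j hj => k44 i hi j (by omega)) i45 b46 r46 b46' (by omega))
  -- Two cyan tiles would require 25 blue tiles or 13 CE tiles.
  have l0 : 3 ≤ (tiles T 0).card := by
    by_contra hlt
    have : 25 ≤ (tiles T 10).card ∨ 25 ≤ 2 * (tiles T 1).card := cyan_le hT hτ (rect 0 6 36 1 53 (by decide)) (rect 10 42 1 2 25 (by decide))
      (rect 9 42 1 27 1 (by decide)) (rect 1 14 25 54 1 (by decide))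
      (rect 8 39 1 54 1 (by decide)) (show (tiles T 0).card ≤ 2 by omega)
    omega
  -- With three cyan, four CE or yellow, two white, two black, and one tile each of the two DGNL
  -- colors and Sat, 7 of the 21 are left.
  have few : ∀ i r b : ℕ, i + r + b ≤ 7 → 2 ≤ i → 1 ≤ r → 1 ≤ b →
      25 ≤ 2 * i * b ∨ 16 ≤ i * r → False := by
    intro i r b h h₁ h₂ h₃ h₄
    have : i ≤ 7 := by omega
    interval_cases i <;> omega
  have d2 : (tiles T 4).card ≤ 1 → 3 ≤ (tiles T 2).card := by
    intro hd
    by_contra hlt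
    exact few (tiles T 6).card (tiles T 9).card (tiles T 10).card (by omega) l6 p9 p10 (diagonal_le_of_card_le hT hτ
      (l := fun k => whiteInstances.getD k (0, 0)) whiteInstances_spec (X := 53) (by norm_num)
      (fun i hi j hj => w53 i hi j (by omega)) i54 b55 r55 b55' hd (by omega))
  have d3 : (tiles T 5).card ≤ 1 → 3 ≤ (tiles T 3).card := by
    intro hd
    by_contra hlt
    exact few (tiles T 6).card (tiles T 9).card (tiles T 10).card (by omega) l6 p9 p10 (diagonal_le_of_card_le hT hτ
      (l := fun k => blackInstances.getD k (0, 0)) blackInstances_spec (X := 44) (by norm_num)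
      k44 i45 b46 r46 b46' hd (by omega))
  have l4 : 2 ≤ (tiles T 4).card := by
    by_contra hlt
    obtain ⟨τ', hτ'⟩ := hτ.placed (.inr (.inl rfl))
    obtain ⟨_, _, _, _, _, _, _, -, h⟩ := run_sound_start hT hcard hτ'
      -- Cyan takes 3 tiles, CE and yellow 4, Sat 1, and black with DGNL-black 4, by `d3` even if
      -- there is only one DGNL-black; this leaves 9.
      (fun P hP => diagonalBudget_of_le (by norm_num) (by norm_num) hP (by omega) (by omega) p4
        (d2 (by omega)) l6 p9 p10) whiteDiagonal_run
    exact absurd h (by simp)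
  have l5 : 2 ≤ (tiles T 5).card := by
    by_contra hlt
    obtain ⟨τ', hτ'⟩ := hτ.placed (.inr (.inr (.inl rfl)))
    obtain ⟨_, _, _, _, _, _, _, -, h⟩ := run_sound_start hT hcard hτ'
      (fun P hP => diagonalBudget_of_le (by norm_num) (by norm_num) hP (by omega) (by omega) p5
        (d3 (by omega)) l6 p9 p10) blackDiagonal_run
    exact absurd h (by simp)
  have l0 : 4 ≤ (tiles T 0).card := by
    by_contra hlt
    obtain ⟨τ', hτ'⟩ := hτ.placed (.inr (.inr (.inr (.inl rfl))))
    obtain ⟨_, _, _, _, _, _, _, -, h⟩ := run_sound_start hT hcard hτ' (bud := cornerBudget)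
      (fun P hP => by
        rw [cornerBudget, Bool.and_eq_true]
        exact ⟨Nat.ble_eq_true_of_le ((hP 0 (by norm_num)).trans (by omega)),
          fullBudget_of_le hP hsum l0 b18 l2 l3 l4 l5 l6 p7 p9 p10⟩) corner_run
    exact absurd h (by simp)
  exact fun P hP => fullBudget_of_le hP hsum l0 b18 l2 l3 l4 l5 l6 p7 p9 p10

/-! ### The isomorphism -/

theorem colorList_length (κ : ℕ → ℕ) (n : ℕ) : (colorList κ n).length = n := by
  induction n with
  | zero => rfl
  | succ n ih => simp [colorList, ih]

theorem colorList_inj {κ κ' : ℕ → ℕ} {n : ℕ} (h : colorList κ n = colorList κ' n) :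
    ∀ u, 1 ≤ u → u ≤ n → κ u = κ' u := by
  induction n with
  | zero => intro u h₁ h₂; omega
  | succ n ih =>
    rw [colorList, colorList, List.cons.injEq] at h
    intro u h₁ h₂
    rcases Nat.lt_or_ge n u with hu | hu
    · obtain rfl : u = n + 1 := by omega
      omega
    · exact ih h.2 u h₁ hu

/-- The nodes of the names `1, …, 21`. -/
def IsNode (i : ℕ) : Prop := ∃ u, 1 ≤ u ∧ u ≤ 21 ∧ (i = u ∨ i = 32 + u)

/-- If the classes are those of the labels of `Teval`, then the label of a node depends only on
its label in `Teval`. -/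
theorem lab_eq_of_labelsOk {glue : ℕ → Glue} {lab : ℕ → L} {n : ℕ} {C : List ℕ}
    (hC : ClassesOk lab n C) (h : labelsOk glue C = true) {i j : ℕ} (hi : IsNode i)
    (hj : IsNode j) (hij : glue i = glue j) : lab i = lab j := by
  have hg := List.all_eq_true.1 h (glue i) (by cases glue i <;> simp)
  have mem : ∀ j, IsNode j → glue j = glue i → ∀ m : ℕ,
      (allBelow (fun u => (decide (glue (u + 1) ≠ glue i) || m.testBit (u + 1)) &&
        (decide (glue (u + 33) ≠ glue i) || m.testBit (u + 33))) 21 = true →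
          m.testBit j = true) ∧
      allBelow (fun u => decide (glue (u + 1) ≠ glue i) &&
        decide (glue (u + 33) ≠ glue i)) 21 = false := by
    rintro j ⟨u, h₁, h₂, hu⟩ hji m
    obtain ⟨u, rfl⟩ := Nat.exists_eq_add_of_le' h₁
    have hu : j = u + 1 ∨ j = u + 33 := by omega
    constructor
    · intro h
      have h := allBelow_iff h u (by omega)
      rw [Bool.and_eq_true] at h
      rcases hu with rfl | rfl
      · simpa [hji] using h.1
      · simpa [hji] using h.2
    · by_contra h
      rw [Bool.not_eq_false] at h
      have h := allBelow_iff h u (by omega)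
      rw [Bool.and_eq_true] at h
      rcases hu with rfl | rfl
      · simp [hji] at h
      · simp [hji] at h
  rw [(mem i hi rfl 0).2, Bool.or_false, List.any_eq_true] at hg
  obtain ⟨m, hm, hg⟩ := hg
  exact (hC m hm i ((mem i hi rfl m).1 hg)).2.2 j ((mem j hj hij.symm m).1 hg)

/-- Labels constant on the fibers of `glue` factor through it; glues of no node get the default
value `lab 0`. -/
theorem exists_label {glue : ℕ → Glue} {lab : ℕ → L}
    (h : ∀ i j, IsNode i → IsNode j → glue i = glue j → lab i = lab j) :
    ∃ f : Glue → L, ∀ i, IsNode i → lab i = f (glue i) := by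
  classical
  refine ⟨fun g => if h : ∃ i, IsNode i ∧ glue i = g then lab h.choose else lab 0,
    fun i hi => ?_⟩
  have hex : ∃ j, IsNode j ∧ glue j = glue i := ⟨i, hi, rfl⟩
  simp only [dif_pos hex]
  exact h i _ hi hex.choose_spec.1 hex.choose_spec.2.symm

theorem namedTile_surj : ∀ t ∈ tevalList, ∃ u ∈ Finset.Icc 1 21, namedTile u = t := by decide

theorem namedTile_mem : ∀ u ∈ Finset.Icc 1 21, namedTile u ∈ tevalList := by decide

/-- Any two horizontal labels of `Teval` occur on the west of tiles with the same label on the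
south. -/
theorem exists_separating_west : ∀ g₁ ∈ [Glue.F, .T, .f, .t, .s], ∀ g₂ ∈ [Glue.F, .T, .f, .t, .s],
    g₁ ≠ g₂ → ∃ t ∈ tevalList, ∃ t' ∈ tevalList,
      t.west = g₁ ∧ t'.west = g₂ ∧ t.south = t'.south := by
  decide +kernel

/-- Any two vertical labels of `Teval` occur on the south of tiles with the same label on the
west. -/
theorem exists_separating_south : ∀ g₁ ∈ [Glue.F, .T, .c, .n, .v],
    ∀ g₂ ∈ [Glue.F, .T, .c, .n, .v], g₁ ≠ g₂ → ∃ t ∈ tevalList, ∃ t' ∈ tevalList,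
      t.south = g₁ ∧ t'.south = g₂ ∧ t.west = t'.west := by
  decide +kernel

theorem mem_of_mem_horizontalLabels {g : Glue} (h : g ∈ horizontalLabels Teval) :
    g ∈ [Glue.F, .T, .f, .t, .s] := by
  have key : ∀ t ∈ tevalList, t.west ∈ [Glue.F, .T, .f, .t, .s] ∧
      t.east ∈ [Glue.F, .T, .f, .t, .s] := by decide
  obtain ⟨t, ht, rfl | rfl⟩ := h
  · exact (key t (List.mem_toFinset.1 ht)).1
  · exact (key t (List.mem_toFinset.1 ht)).2

theorem mem_of_mem_verticalLabels {g : Glue} (h : g ∈ verticalLabels Teval) :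
    g ∈ [Glue.F, .T, .c, .n, .v] := by
  have key : ∀ t ∈ tevalList, t.north ∈ [Glue.F, .T, .c, .n, .v] ∧
      t.south ∈ [Glue.F, .T, .c, .n, .v] := by decide
  obtain ⟨t, ht, rfl | rfl⟩ := h
  · exact (key t (List.mem_toFinset.1 ht)).1
  · exact (key t (List.mem_toFinset.1 ht)).2

/-- The search only proves equalities of labels, which suffices to define the renamings. That no
further labels are equal follows from directedness and the distinctness of the 21 names. -/
theorem isomorphic_of_interp {T : Finset (TileType L)} (hT : Directed T) (hcard : T.card ≤ 21)
    {τ : ℕ → TileType L} {A n P : ℕ} {cols H V : List ℕ} {ν : ℕ → TileType L}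
    (h : Interp T τ A n P cols H V ν) (hf : isTeval cols H V = true) :
    21 ≤ T.card ∧ Isomorphic Teval T := by
  simp only [isTeval, Bool.and_eq_true, decide_eq_true_eq] at hf
  obtain ⟨hcols, hH, hV⟩ := hf
  have hcols := h.cols_eq.symm.trans hcols
  obtain rfl : n = 21 := by
    simpa [colorList_length] using congrArg List.length hcols
  have hcol := colorList_inj hcols
  have h21 := h.naming.le_card
  refine ⟨h21, ?_⟩
  obtain ⟨f, hf⟩ := exists_label fun i j => lab_eq_of_labelsOk h.classesH hH (i := i) (j := j)
  obtain ⟨g, hg⟩ := exists_label fun i j => lab_eq_of_labelsOk h.classesV hV (i := i) (j := j)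
  have rename : ∀ u, 1 ≤ u → u ≤ 21 → TileType.rename f g (namedTile u) = ν u := by
    intro u h₁ h₂
    have a₁ := hf u ⟨u, h₁, h₂, .inl rfl⟩
    have a₂ := hf (32 + u) ⟨u, h₁, h₂, .inr rfl⟩
    have a₃ := hg u ⟨u, h₁, h₂, .inl rfl⟩
    have a₄ := hg (32 + u) ⟨u, h₁, h₂, .inr rfl⟩
    have a₅ := hcol u h₁ h₂
    have hlt : u < 32 := by omega
    simp [labH, labV, hlt] at a₁ a₂ a₃ a₄
    exact TileType.ext a₄.symm a₁.symm a₃.symm a₂.symm a₅.symm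
  have mem : ∀ t ∈ tevalList, TileType.rename f g t ∈ T := by
    intro t ht
    obtain ⟨u, hu, rfl⟩ := namedTile_surj t ht
    rw [Finset.mem_Icc] at hu
    rw [rename u hu.1 hu.2]
    exact h.naming.mem u hu.1 hu.2
  have inj : ∀ t ∈ tevalList, ∀ t' ∈ tevalList,
      TileType.rename f g t = TileType.rename f g t' → t = t' := by
    intro t ht t' ht' e
    obtain ⟨u, hu, rfl⟩ := namedTile_surj t ht
    obtain ⟨u', hu', rfl⟩ := namedTile_surj t' ht'
    rw [Finset.mem_Icc] at hu hu'
    rw [rename u hu.1 hu.2, rename u' hu'.1 hu'.2] at e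
    rw [h.naming.inj u u' hu.1 hu.2 hu'.1 hu'.2 e]
  refine ⟨f, g, ?_, ?_, ?_⟩
  · intro g₁ h₁ g₂ h₂ e
    by_contra hne
    -- If `f` merged two glues, the separating tiles would be renamed to tiles with equal west and
    -- south labels, hence to one tile, although they have different names.
    obtain ⟨t, ht, t', ht', rfl, rfl, hs⟩ := exists_separating_west g₁
      (mem_of_mem_horizontalLabels h₁) g₂ (mem_of_mem_horizontalLabels h₂) hne
    have := inj t ht t' ht' (hT.eq (mem t ht) (mem t' ht') e (congrArg g hs))
    exact hne (congrArg _ this)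
  · intro g₁ h₁ g₂ h₂ e
    by_contra hne
    obtain ⟨t, ht, t', ht', rfl, rfl, hs⟩ := exists_separating_south g₁
      (mem_of_mem_verticalLabels h₁) g₂ (mem_of_mem_verticalLabels h₂) hne
    have := inj t ht t' ht' (hT.eq (mem t ht) (mem t' ht') (congrArg f hs) e)
    exact hne (congrArg _ this)
  · classical
    -- The 21 distinct named tiles exhaust `T`, which has at most 21.
    have himg : (Finset.Icc 1 21).image ν = T := by
      refine Finset.eq_of_subset_of_card_le ?_ ?_
      · intro t ht
        obtain ⟨u, hu, rfl⟩ := Finset.mem_image.1 ht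
        rw [Finset.mem_Icc] at hu
        exact h.naming.mem u hu.1 hu.2
      · rw [Finset.card_image_of_injOn fun u hu v hv e => by
          rw [Finset.mem_coe, Finset.mem_Icc] at hu hv
          exact h.naming.inj u v hu.1 hu.2 hv.1 hv.2 e]
        simpa using hcard
    ext t
    simp only [Set.mem_image, Finset.mem_coe]
    constructor
    · rintro ⟨t, ht, rfl⟩
      exact mem t (List.mem_toFinset.1 ht)
    · intro ht
      rw [← himg] at ht
      obtain ⟨u, hu, rfl⟩ := Finset.mem_image.1 ht
      have hu' := Finset.mem_Icc.1 hu
      exact ⟨namedTile u, List.mem_toFinset.2 (namedTile_mem u hu), rename u hu'.1 hu'.2⟩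

theorem isomorphic_of_gadgetTiling {T : Finset (TileType L)} {τ : ℕ → ℕ → TileType L}
    (hT : Directed T) (hcard : T.card ≤ 21) (hτ : GadgetTiling T τ) :
    21 ≤ T.card ∧ Isomorphic Teval T := by
  obtain ⟨τ', hτ'⟩ := hτ.placed (.inr (.inr (.inr (.inr rfl))))
  obtain ⟨_, _, _, _, _, _, _, h, hf⟩ :=
    run_sound_start hT hcard hτ' (card_tiles hT hcard hτ) tight_run
  exact isomorphic_of_interp hT hcard h hf

end RTAS

theorem mainTheorem2 {L : Type*} (T : Finset (RTAS.TileType L)) (hT : RTAS.Directed T)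
    (σ : RTAS.Seed L) (P : RTAS.Pattern σ.width σ.height) (hP : P.Includes RTAS.gadget) :
    (T.card ≤ 21 → RTAS.UniquelySelfAssembles T σ P → RTAS.Isomorphic RTAS.Teval T) ∧
      (T.card < 21 → ¬ RTAS.UniquelySelfAssembles T σ P) := by
  constructor
  · intro hcard h
    obtain ⟨τ, hτ⟩ := RTAS.exists_gadgetTiling hP h.1
    exact (RTAS.isomorphic_of_gadgetTiling hT hcard hτ).2
  · intro hcard h
    obtain ⟨τ, hτ⟩ := RTAS.exists_gadgetTiling hP h.1
    exact absurd (RTAS.isomorphic_of_gadgetTiling hT hcard.le hτ).1 (by omega)
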